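/- Let $U\subseteq\mathbb R^n$ be open, $K\subset U$ compact, $f,g:U\to\mathbb R^n$ smooth, and let $S=\{x: c(x)=0\}$ be a hyperplane with $c(x)=z'x-b$, $z\neq 0$. Consider the hybrid system $\dot x=f(x)$ for $x\notin S$, $x^+=g(x)$ for $x\in S$; solutions are taken right-continuous, so that at an impact time $t$ the left limit $x(t^-)$ lies on $S$ and $x(t)=g(x(t^-))$ (and $x(0)=g(x_0)$ if the initial state $x_0$ lies on $S$), while $x(t)\notin S$ for all $t\ge 0$. Assume that - $K$ is strictly forward invariant: from each initial state in $K$ there is a solution on $[0,\infty)$, and every solution starting in $K$ is in the interior of $K$ for all $t>0$; - $K$ is a single continuous tube: $K\setminus S$ is connected, every solution starting in $K\setminus S$ reaches $S$, $f(x)\ne0$ for all $x\in K$, and $f(x)'z\neq0$ for all $x\in K\cap S$. Let $M(x)$ be a smooth Riemannian metric on $U$ (a symmetric positive definite matrix depending smoothly on $x$) and $V(x,\delta)=\sqrt{\delta'M(x)\delta}$. Suppose that 1. (transverse contraction) there is $\lambda>0$ such that for all $x\in K$ and all $\delta\neq0$ with $\frac{\partial V}{\partial\delta}f(x)=0$,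 $$\frac{\partial V(x,\delta)}{\partial x}f(x)+\frac{\partial V(x,\delta)}{\partial\delta}\frac{\partial f(x)}{\partial x}\delta\le-\lambda V(x,\delta);$$ 2. (orthogonality) $f(x)'M(x)\delta=0$ for all $x\in K\cap S$ and all $\delta$ tangent to $S$, i.e. with $z'\delta=0$; 3. (impulse) for all $x\in K\cap S$ and all $\delta$ with $\delta'M(x)f(x)=0$, $$\delta'\frac{\partial g}{\partial x}(x)'\,M(g(x))\,\frac{\partial g}{\partial x}(x)\,\delta\le\delta'M(x)\delta .$$ Then for every pair of solutions $x_1,x_2$ starting in $K$ there is a time reparameterization, i.e. an increasing homeomorphism $\tau:[0,\infty)\to[0,\infty)$, such that $\|x_1(t)-x_2(\tau(t))\|\to0$ as $t\to\infty$. -/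

import Mathlib

open Set Filter Topology
open scoped ContDiff

/-- The flat switching surface `S = {x | c x = 0}` with `c x = ⟪z, x⟫ - b`; `z` is its normal. -/
def switchingSurface {n : ℕ} (z : EuclideanSpace ℝ (Fin n)) (b : ℝ) :
    Set (EuclideanSpace ℝ (Fin n)) :=
  {x | inner ℝ z x - b = 0}

/-- `x : [0, ∞) → ℝⁿ` is the solution curve, started at `x₀`, of the hybrid system
`ẋ = f x` off `S`, `x⁺ = g x⁻` on `S`. Curves are normalised to be right-continuous: at an impact
time (including time `0` when `x₀ ∈ S`) the value `x t` is the state right after the impulse, and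
the state right before it is the left limit. (Values at negative times are irrelevant.) -/
structure IsHybridSolution {n : ℕ} (f g : EuclideanSpace ℝ (Fin n) → EuclideanSpace ℝ (Fin n))
    (S : Set (EuclideanSpace ℝ (Fin n))) (x₀ : EuclideanSpace ℝ (Fin n))
    (x : ℝ → EuclideanSpace ℝ (Fin n)) : Prop where
  init_flow : x₀ ∉ S → x 0 = x₀
  init_jump : x₀ ∈ S → x 0 = g x₀
  /-- After a possible impulse the state is off `S` and flows along `f`. -/
  flow : ∀ t, 0 ≤ t → x t ∉ S ∧ HasDerivWithinAt x (f (x t)) (Ici t) t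
  /-- Every positive time is an ordinary time of the flow or an impact time. -/
  flow_or_jump : ∀ t, 0 < t →
    HasDerivAt x (f (x t)) t ∨ ∃ p ∈ S, Tendsto x (𝓝[<] t) (𝓝 p) ∧ x t = g p

/-- `K` is strictly forward invariant: the hybrid system has a solution for all times from every
point of `K`, and any such solution is in the interior of `K` for all `t > 0`. -/
def StrictlyForwardInvariant {n : ℕ}
    (f g : EuclideanSpace ℝ (Fin n) → EuclideanSpace ℝ (Fin n))
    (S K : Set (EuclideanSpace ℝ (Fin n))) : Prop :=
  ∀ x₀ ∈ K, (∃ x, IsHybridSolution f g S x₀ x) ∧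
    ∀ x, IsHybridSolution f g S x₀ x → ∀ t, 0 < t → x t ∈ interior K

/-- The solution curve `x` runs into the surface `S` at some positive time. -/
def ReachesSurface {n : ℕ} (S : Set (EuclideanSpace ℝ (Fin n)))
    (x : ℝ → EuclideanSpace ℝ (Fin n)) : Prop :=
  ∃ t, 0 < t ∧ ∃ p ∈ S, Tendsto x (𝓝[<] t) (𝓝 p)

/-- A smooth Riemannian metric on `U`: a smooth field of symmetric positive definite bilinear
forms, `M x u v` being `u' M(x) v`. -/
structure IsRiemannianMetricOn {n : ℕ}
    (M : EuclideanSpace ℝ (Fin n) →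
      EuclideanSpace ℝ (Fin n) →L[ℝ] EuclideanSpace ℝ (Fin n) →L[ℝ] ℝ)
    (U : Set (EuclideanSpace ℝ (Fin n))) : Prop where
  smooth : ContDiffOn ℝ ∞ M U
  symm : ∀ x ∈ U, ∀ u v, M x u v = M x v u
  posDef : ∀ x ∈ U, ∀ v, v ≠ 0 → 0 < M x v v

/-- The Riemannian length `V(x, δ) = √(δ' M(x) δ)` of a virtual displacement. -/
noncomputable def metricNorm {n : ℕ}
    (M : EuclideanSpace ℝ (Fin n) →
      EuclideanSpace ℝ (Fin n) →L[ℝ] EuclideanSpace ℝ (Fin n) →L[ℝ] ℝ)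
    (x δ : EuclideanSpace ℝ (Fin n)) : ℝ :=
  Real.sqrt (M x δ δ)

/-- Transverse contraction of `ẋ = f x` on `K` with rate `r` in the metric `M`:
`∂V/∂x f(x) + ∂V/∂δ (∂f/∂x) δ ≤ -r V` for all `δ ≠ 0` with `∂V/∂δ f(x) = 0`. -/
def TransverseContractingOn {n : ℕ}
    (f : EuclideanSpace ℝ (Fin n) → EuclideanSpace ℝ (Fin n))
    (M : EuclideanSpace ℝ (Fin n) →
      EuclideanSpace ℝ (Fin n) →L[ℝ] EuclideanSpace ℝ (Fin n) →L[ℝ] ℝ)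
    (K : Set (EuclideanSpace ℝ (Fin n))) (r : ℝ) : Prop :=
  ∀ x ∈ K, ∀ δ : EuclideanSpace ℝ (Fin n), δ ≠ 0 →
    fderiv ℝ (fun η => metricNorm M x η) δ (f x) = 0 →
    fderiv ℝ (fun y => metricNorm M y δ) x (f x)
        + fderiv ℝ (fun η => metricNorm M x η) δ (fderiv ℝ f x δ)
      ≤ -r * metricNorm M x δ

/-!
The proof compares neighbouring solutions directly, by finite differences, so that no
differentiability of the flow or of the hitting time in the initial state is needed.

Between two impacts a hybrid solution is an *arc*: a trajectory of `f` in `K` that ends on `S`.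
Let `u`, `v` be two arcs with nearby initial states, run at natural speed, let `T ≤ T'` be their
durations, and write `v - u = N + θ f(u)` with `N` orthogonal to `f(u)` for the metric `M(u)`.
Since `f(u)` itself solves the linearised equation, the flow component only contributes multiples
of `M(f, N) = 0` to the derivative of `M(N, N)`, and transverse contraction makes `M(N, N)` decay
like `exp (-2 r t)`, up to an error of third order in the initial distance
(`IsArc.exists_transverse_energy_le`). When `u` hits `S` transversally at `p`, the arc `v` hits it
soon after, at `q`; the last piece of `v` is parallel to `f(p)` up to second order, and `q - p` is
tangent to the flat surface `S`, hence orthogonal to `f(p)` by the orthogonality condition. So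
`q - p` equals `N` up to second order, the impulse does not expand it, and altogether
(`ContractingTube.exists_step`)
`M(g p)(g q - g p, g q - g p) ≤ exp (-2 r T) M(u 0)(v 0 - u 0, v 0 - u 0) + O(|v 0 - u 0|³)`.

The states after impulses lie in the compact set `g '' (K ∩ S)`, which is disjoint from `S`; hence
the durations of arcs are bounded above and away from `0`, and close states contract geometrically
(`ContractingTube.exists_contraction`). Matching the `k`-th arcs of the two solutions affinely then
gives a time change that makes them asymptotic (`ContractingTube.exists_asymptotic`). Being
asymptotic up to a time change is an equivalence relation on initial states whose classes are
therefore open in the preconnected set `K \ S`, so there is only one class.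
-/

/-! ### Smooth maps on compact sets -/

section SmoothOnCompact

variable {E F : Type*} [NormedAddCommGroup E] [NormedSpace ℝ E]
  [NormedAddCommGroup F] [NormedSpace ℝ F] {h : E → F} {K U : Set E}

theorem ContDiffOn.exists_norm_sub_le_of_isCompact (hU : IsOpen U) (hKU : K ⊆ U)
    (hK : IsCompact K) (hh : ContDiffOn ℝ 1 h U) :
    ∃ C, ∀ x ∈ K, ∀ y ∈ K, ‖h y - h x‖ ≤ C * ‖y - x‖ := by
  have hloc : LocallyLipschitzOn K h := by
    intro x hx
    obtain ⟨C, t, ht, hC⟩ :=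
      (hh.contDiffAt (hU.mem_nhds (hKU hx))).exists_lipschitzOnWith
    exact ⟨C, t, mem_nhdsWithin_of_mem_nhds ht, hC⟩
  obtain ⟨C, hC⟩ := hloc.exists_lipschitzOnWith_of_compact hK
  exact ⟨C, fun x hx y hy => hC.norm_sub_le hy hx⟩

theorem ContDiffOn.exists_norm_sub_fderiv_le_of_isCompact [ProperSpace E] (hU : IsOpen U)
    (hKU : K ⊆ U) (hK : IsCompact K) (hh : ContDiffOn ℝ ∞ h U) :
    ∃ C, ∀ x ∈ K, ∀ y ∈ K, ‖h y - h x - fderiv ℝ h x (y - x)‖ ≤ C * ‖y - x‖ ^ 2 := by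
  obtain ⟨ρ, hρ, hρU⟩ := hK.exists_cthickening_subset_open hU hKU
  have hd : ContDiffOn ℝ 1 (fderiv ℝ h) U := 
    hh.fderiv_of_isOpen hU (WithTop.coe_le_coe.2 le_top)
  obtain ⟨C₁, hC₁⟩ := ContDiffOn.exists_norm_sub_le_of_isCompact hU hρU hK.cthickening hd
  obtain ⟨C₂, hC₂⟩ := ContDiffOn.exists_norm_sub_le_of_isCompact hU hKU hK
    (hh.of_le (by exact_mod_cast le_top))
  obtain ⟨C₃, hC₃⟩ := hK.exists_bound_of_continuousOn (hd.continuousOn.mono hKU)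
  refine ⟨|C₁| + (|C₂| + |C₃|) / ρ, fun x hx y hy => ?_⟩
  have hn := norm_nonneg (y - x)
  have hq : 0 ≤ (|C₂| + |C₃|) / ρ := by positivity
  rcases le_total ‖y - x‖ ρ with hle | hlt
  · -- the ball around `x` through `y` stays in the compact thickening, where `fderiv h` is Lipschitz
    have hsub : Metric.closedBall x ‖y - x‖ ⊆ Metric.cthickening ρ K :=
      (Metric.closedBall_subset_closedBall hle).trans (Metric.closedBall_subset_cthickening hx ρ)
    have hxB : x ∈ Metric.closedBall x ‖y - x‖ := by simp
    have hyB : y ∈ Metric.closedBall x ‖y - x‖ := by simp [dist_eq_norm]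
    have key := (convex_closedBall x ‖y - x‖).norm_image_sub_le_of_norm_hasFDerivWithin_le'
      (f := h) (f' := fderiv ℝ h) (φ := fderiv ℝ h x) (C := |C₁| * ‖y - x‖)
      (fun w hw => (((hh.contDiffAt (hU.mem_nhds (hρU (hsub hw)))).differentiableAt
        (by simp)).hasFDerivAt).hasFDerivWithinAt)
      (fun w hw => by
        refine (hC₁ x (hsub hxB) w (hsub hw)).trans ?_
        have : ‖w - x‖ ≤ ‖y - x‖ := by simpa [dist_eq_norm] using hw
        exact mul_le_mul (le_abs_self _) this (norm_nonneg _) (abs_nonneg _)) hxB hyB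
    nlinarith [mul_nonneg hq (sq_nonneg ‖y - x‖)]
  · have h1 : ‖h y - h x‖ ≤ |C₂| * ‖y - x‖ :=
      (hC₂ x hx y hy).trans (mul_le_mul_of_nonneg_right (le_abs_self _) hn)
    have h2 : ‖fderiv ℝ h x (y - x)‖ ≤ |C₃| * ‖y - x‖ :=
      ((fderiv ℝ h x).le_opNorm _).trans
        (mul_le_mul_of_nonneg_right ((hC₃ x hx).trans (le_abs_self _)) hn)
    have h3 : (|C₂| + |C₃|) * ‖y - x‖ ≤ (|C₂| + |C₃|) / ρ * ‖y - x‖ ^ 2 := by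
      rw [div_mul_eq_mul_div, le_div_iff₀ hρ, pow_two, ← mul_assoc]
      exact mul_le_mul_of_nonneg_left hlt (by positivity)
    have h4 := norm_sub_le (h y - h x) (fderiv ℝ h x (y - x))
    nlinarith [mul_nonneg (abs_nonneg C₁) (sq_nonneg ‖y - x‖)]

theorem exists_sq_norm_le_mul_of_isCompact [ProperSpace E] {M : E → E →L[ℝ] E →L[ℝ] ℝ}
    (hK : IsCompact K) (hM : ContinuousOn M K) (hpos : ∀ x ∈ K, ∀ v, v ≠ 0 → 0 < M x v v) :
    ∃ C, ∀ x ∈ K, ∀ v, ‖v‖ ^ 2 ≤ C * M x v v := by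
  have hc : ContinuousOn (fun p : E × E => (M p.1 p.2 p.2)⁻¹) (K ×ˢ Metric.sphere (0 : E) 1) := by
    refine ContinuousOn.inv₀ ?_ ?_
    · exact ((hM.comp continuousOn_fst fun p hp => hp.1).clm_apply continuousOn_snd).clm_apply
        continuousOn_snd
    · rintro ⟨x, v⟩ ⟨hx, hv⟩
      exact (hpos x hx v (ne_zero_of_mem_unit_sphere ⟨v, hv⟩)).ne'
  obtain ⟨C, hC⟩ := (hK.prod (isCompact_sphere (0 : E) 1)).exists_bound_of_continuousOn hc
  refine ⟨C, fun x hx v => ?_⟩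
  rcases eq_or_ne v 0 with rfl | hv
  · simp
  have hv' : 0 < ‖v‖ := norm_pos_iff.2 hv
  have h1 : ‖v‖⁻¹ • v ∈ Metric.sphere (0 : E) 1 := by
    simp [norm_smul, inv_mul_cancel₀ hv'.ne']
  have h2 := (le_abs_self _).trans (hC (x, ‖v‖⁻¹ • v) ⟨hx, h1⟩)
  have h3 := hpos x hx v hv
  simp only [map_smul, smul_apply, smul_eq_mul, mul_inv, inv_inv] at h2
  have h4 := mul_le_mul_of_nonneg_right h2 h3.le
  rwa [← mul_assoc, mul_assoc _ _ (M x v v), inv_mul_cancel₀ h3.ne', mul_one, ← pow_two] at h4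

/-- All the quantitative information on the field `f`, the impulse `g` and the metric `M` on the
compact set `K`, expressed with a single constant `L`. -/
structure UniformBounds (f g : E → E) (M : E → E →L[ℝ] E →L[ℝ] ℝ) (K : Set E) (L : ℝ) : Prop where
  one_le : 1 ≤ L
  norm_field : ∀ x ∈ K, ‖f x‖ ≤ L
  lip_field : ∀ x ∈ K, ∀ y ∈ K, ‖f y - f x‖ ≤ L * ‖y - x‖
  taylor_field : ∀ x ∈ K, ∀ y ∈ K, ‖f y - f x - fderiv ℝ f x (y - x)‖ ≤ L * ‖y - x‖ ^ 2
  lip_jump : ∀ x ∈ K, ∀ y ∈ K, ‖g y - g x‖ ≤ L * ‖y - x‖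
  taylor_jump : ∀ x ∈ K, ∀ y ∈ K, ‖g y - g x - fderiv ℝ g x (y - x)‖ ≤ L * ‖y - x‖ ^ 2
  norm_metric : ∀ x ∈ K, ‖M x‖ ≤ L
  lip_metric : ∀ x ∈ K, ∀ y ∈ K, ‖M y - M x‖ ≤ L * ‖y - x‖
  sq_norm_le : ∀ x ∈ K, ∀ v, ‖v‖ ^ 2 ≤ L * M x v v

theorem exists_uniformBounds [ProperSpace E] {f g : E → E} {M : E → E →L[ℝ] E →L[ℝ] ℝ}
    (hU : IsOpen U) (hKU : K ⊆ U) (hK : IsCompact K) (hf : ContDiffOn ℝ ∞ f U)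
    (hg : ContDiffOn ℝ ∞ g U) (hM : ContDiffOn ℝ ∞ M U)
    (hpos : ∀ x ∈ U, ∀ v, v ≠ 0 → 0 < M x v v) : ∃ L, UniformBounds f g M K L := by
  obtain ⟨C₁, h₁⟩ := hK.exists_bound_of_continuousOn (hf.continuousOn.mono hKU)
  obtain ⟨C₂, h₂⟩ := ContDiffOn.exists_norm_sub_le_of_isCompact hU hKU hK
    (hf.of_le (by exact_mod_cast le_top))
  obtain ⟨C₃, h₃⟩ := ContDiffOn.exists_norm_sub_fderiv_le_of_isCompact hU hKU hK hf
  obtain ⟨C₄, h₄⟩ := ContDiffOn.exists_norm_sub_le_of_isCompact hU hKU hK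
    (hg.of_le (by exact_mod_cast le_top))
  obtain ⟨C₅, h₅⟩ := ContDiffOn.exists_norm_sub_fderiv_le_of_isCompact hU hKU hK hg
  obtain ⟨C₆, h₆⟩ := (hK.image_of_continuousOn (hM.continuousOn.mono hKU)).isBounded.exists_norm_le
  obtain ⟨C₇, h₇⟩ := ContDiffOn.exists_norm_sub_le_of_isCompact hU hKU hK
    (hM.of_le (by exact_mod_cast le_top))
  obtain ⟨C₈, h₈⟩ := exists_sq_norm_le_mul_of_isCompact hK (hM.continuousOn.mono hKU)
    fun x hx => hpos x (hKU hx)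
  have hnn : ∀ x ∈ K, ∀ v, 0 ≤ M x v v := fun x hx v => by
    rcases eq_or_ne v 0 with rfl | hv
    · simp
    · exact (hpos x (hKU hx) v hv).le
  obtain ⟨L, hL⟩ : ∃ L, L ∈ upperBounds ({1, C₁, C₂, C₃, C₄, C₅, C₆, C₇, C₈} : Set ℝ) :=
    (Set.toFinite _).bddAbove
  simp only [mem_upperBounds, mem_insert_iff, mem_singleton_iff, forall_eq_or_imp,
    forall_eq] at hL
  obtain ⟨l0, l1, l2, l3, l4, l5, l6, l7, l8⟩ := hL
  exact ⟨L, l0, fun x hx => (h₁ x hx).trans l1,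
    fun x hx y hy => (h₂ x hx y hy).trans (by gcongr),
    fun x hx y hy => (h₃ x hx y hy).trans (by gcongr),
    fun x hx y hy => (h₄ x hx y hy).trans (by gcongr),
    fun x hx y hy => (h₅ x hx y hy).trans (by gcongr),
    fun x hx => (h₆ _ (mem_image_of_mem M hx)).trans l6,
    fun x hx y hy => (h₇ x hx y hy).trans (by gcongr),
    fun x hx v => (h₈ x hx v).trans (mul_le_mul_of_nonneg_right l8 (hnn x hx v))⟩

end SmoothOnCompact

/-! ### Arcs between impacts -/

section Arcs

variable {E : Type*} [NormedAddCommGroup E] [InnerProductSpace ℝ E]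
  {f g : E → E} {M : E → E →L[ℝ] E →L[ℝ] ℝ} {K S : Set E} {L T T' m b : ℝ} {u v : ℝ → E} {z : E}

/-- `u` restricted to `[0, T]` is a trajectory of `ẋ = f x` inside `K` that meets `S` at time `T`
and not before. In contrast to the right-continuous hybrid solutions, the value `u T` is the state
just before the impulse, so that `u` is continuous on the closed interval. -/
structure IsArc (f : E → E) (K S : Set E) (T : ℝ) (u : ℝ → E) : Prop where
  pos : 0 < T
  cont : ContinuousOn u (Icc 0 T)
  deriv : ∀ t ∈ Ico 0 T, HasDerivWithinAt u (f (u t)) (Ici t) t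
  mem : ∀ t ∈ Icc 0 T, u t ∈ K
  notMem : ∀ t ∈ Ico 0 T, u t ∉ S
  hit : u T ∈ S

theorem IsArc.mem_start (hu : IsArc f K S T u) : u 0 ∈ K := hu.mem 0 ⟨le_rfl, hu.pos.le⟩

theorem IsArc.mem_end (hu : IsArc f K S T u) : u T ∈ K := hu.mem T ⟨hu.pos.le, le_rfl⟩

theorem IsArc.norm_sub_le (H : UniformBounds f g M K L) (hu : IsArc f K S T u) {s t : ℝ}
    (hs : 0 ≤ s) (hst : s ≤ t) (ht : t ≤ T) : ‖u t - u s‖ ≤ L * (t - s) :=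
  norm_image_sub_le_of_norm_deriv_right_le_segment
    (hu.cont.mono (Icc_subset_Icc hs ht))
    (fun r hr => hu.deriv r ⟨hs.trans hr.1, hr.2.trans_le ht⟩)
    (fun r hr => H.norm_field _ (hu.mem r ⟨hs.trans hr.1, (hr.2.trans_le ht).le⟩)) t ⟨hst, le_rfl⟩

/-- Over a short time an arc is close to the straight motion with any nearby velocity `f x₀`. -/
theorem IsArc.norm_sub_smul_le (H : UniformBounds f g M K L) (hu : IsArc f K S T u) {s t : ℝ}
    (hs : 0 ≤ s) (hst : s ≤ t) (ht : t ≤ T) {x₀ : E} (hx₀ : x₀ ∈ K) :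
    ‖u t - u s - (t - s) • f x₀‖ ≤ L * (‖u s - x₀‖ + L * (t - s)) * (t - s) := by
  have hL := zero_le_one.trans H.one_le
  have key := norm_image_sub_le_of_norm_deriv_right_le_segment
    (f := fun r => u r - (r - s) • f x₀) (f' := fun r => f (u r) - f x₀) (a := s) (b := t)
    (C := L * (‖u s - x₀‖ + L * (t - s)))
    ((hu.cont.mono (Icc_subset_Icc hs ht)).sub (by fun_prop))
    (fun r hr => by
      refine (hu.deriv r ⟨hs.trans hr.1, hr.2.trans_le ht⟩).sub ?_
      simpa using (((hasDerivAt_id r).sub_const s).smul_const (f x₀)).hasDerivWithinAt)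
    (fun r hr => by
      refine (H.lip_field _ hx₀ _ (hu.mem r ⟨hs.trans hr.1, (hr.2.trans_le ht).le⟩)).trans ?_
      have h1 := hu.norm_sub_le H hs hr.1 (hr.2.le.trans ht)
      have h2 : ‖u r - x₀‖ ≤ ‖u r - u s‖ + ‖u s - x₀‖ := norm_sub_le_norm_sub_add_norm_sub _ _ _
      have h3 : L * (r - s) ≤ L * (t - s) := by gcongr; exact hr.2.le
      gcongr
      linarith) t ⟨hst, le_rfl⟩
  simp only [sub_self, zero_smul, sub_zero] at key
  rwa [sub_right_comm] at key

theorem IsArc.norm_sub_le_exp (H : UniformBounds f g M K L) (hu : IsArc f K S T u)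
    (hv : IsArc f K S T' v) (hTT : T ≤ T') {t : ℝ} (ht : t ∈ Icc 0 T) :
    ‖v t - u t‖ ≤ ‖v 0 - u 0‖ * Real.exp (L * t) := by
  have hL := zero_le_one.trans H.one_le
  have := dist_le_of_trajectories_ODE_of_mem (v := fun _ => f) (s := fun _ => K)
    (K := L.toNNReal) (f := v) (g := u) (a := 0) (b := T) (δ := ‖v 0 - u 0‖)
    (fun t _ => LipschitzOnWith.of_dist_le_mul fun x hx y hy => by
      simpa [dist_eq_norm, hL] using H.lip_field y hy x hx)
    (hv.cont.mono (Icc_subset_Icc le_rfl hTT))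
    (fun t ht => hv.deriv t ⟨ht.1, ht.2.trans_le hTT⟩)
    (fun t ht => hv.mem t ⟨ht.1, (ht.2.trans_le hTT).le⟩)
    hu.cont hu.deriv (fun t ht => hu.mem t ⟨ht.1, ht.2.le⟩) (dist_eq_norm _ _).le t ht
  simpa [dist_eq_norm, hL] using this

/-- An arc coming from the side `⟪z, x⟫ < b` crosses the hyperplane with nonnegative speed. -/
theorem IsArc.inner_end_nonneg (H : UniformBounds f g M K L) (hS : ∀ x, x ∈ S ↔ inner ℝ z x = b)
    (hside : ∀ x ∈ K \ S, inner ℝ z x < b) (hu : IsArc f K S T u) :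
    0 ≤ inner ℝ z (f (u T)) := by
  have hL := zero_le_one.trans H.one_le
  -- over the last `η` time units, the mean speed is positive and `O(η)`-close to the final one
  have key : ∀ η ∈ Ioc 0 T, -(‖z‖ * (L * (2 * L))) * η ≤ inner ℝ z (f (u T)) := by
    rintro η ⟨h0, h1⟩
    have hs : 0 ≤ T - η := by linarith
    have d1 := hu.norm_sub_smul_le H hs (sub_le_self T h0.le) le_rfl hu.mem_end
    have d2 := hu.norm_sub_le H hs (sub_le_self T h0.le) le_rfl
    rw [norm_sub_rev] at d2
    simp only [sub_sub_cancel] at d1 d2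
    have d3 := hside _ ⟨hu.mem (T - η) ⟨hs, by linarith⟩, hu.notMem _ ⟨hs, by linarith⟩⟩
    have d4 := (hS _).1 hu.hit
    have d5 := (le_abs_self _).trans (abs_real_inner_le_norm z (u T - u (T - η) - η • f (u T)))
    rw [inner_sub_right, inner_sub_right, inner_smul_right] at d5
    have d6 : ‖z‖ * ‖u T - u (T - η) - η • f (u T)‖ ≤ ‖z‖ * (L * (L * η + L * η) * η) := by
      refine mul_le_mul_of_nonneg_left (d1.trans ?_) (norm_nonneg _)
      gcongr
    have d7 : 0 ≤ η * (inner ℝ z (f (u T)) + ‖z‖ * (L * (2 * L)) * η) := by nlinarith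
    linarith [nonneg_of_mul_nonneg_right d7 h0]
  have hlim : Tendsto (fun η : ℝ => -(‖z‖ * (L * (2 * L))) * η) (𝓝[>] 0) (𝓝 0) := by
    have : Continuous fun η : ℝ => -(‖z‖ * (L * (2 * L))) * η := by fun_prop
    simpa using (this.tendsto 0).mono_left nhdsWithin_le_nhds
  exact le_of_tendsto hlim (by filter_upwards [Ioc_mem_nhdsGT hu.pos] with η hη using key η hη)

/-- By compactness, transversality to the hyperplane is uniform over the impact points. -/
theorem exists_le_inner_field (hK : IsCompact K) (hf : ContinuousOn f K)
    (hS : ∀ x, x ∈ S ↔ inner ℝ z x = b) (htrans : ∀ x ∈ K ∩ S, inner ℝ (f x) z ≠ 0) :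
    ∃ m > 0, ∀ x ∈ K ∩ S, 0 ≤ inner ℝ z (f x) → m ≤ inner ℝ z (f x) := by
  have hSc : IsClosed S := by
    have : S = {x | inner ℝ z x = b} := by ext x; exact hS x
    rw [this]
    exact isClosed_eq (by fun_prop) continuous_const
  have hc : ContinuousOn (fun x => (inner ℝ z (f x))⁻¹) (K ∩ S) :=
    (continuousOn_const.inner (hf.mono inter_subset_left)).inv₀ fun x hx => by
      rw [real_inner_comm]; exact htrans x hx
  obtain ⟨C, hC⟩ := (hK.inter_right hSc).exists_bound_of_continuousOn hc
  refine ⟨(max C 1)⁻¹, by positivity, fun x hx h0 => ?_⟩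
  have hpos : 0 < inner ℝ z (f x) :=
    lt_of_le_of_ne h0 (by rw [real_inner_comm]; exact (htrans x hx).symm)
  refine inv_le_of_inv_le₀ hpos ?_
  exact ((le_abs_self _).trans (hC x hx)).trans (le_max_left _ _)

/-- If `v` is still before its impact when `u` has its impact, and `v T` is within `D` of the
impact point `u T`, then `v` has its impact within a time proportional to `D`. -/
theorem IsArc.sub_le_of_norm_sub_le (H : UniformBounds f g M K L)
    (hS : ∀ x, x ∈ S ↔ inner ℝ z x = b) (hside : ∀ x ∈ K \ S, inner ℝ z x < b) (hm : 0 < m)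
    (hfm : ∀ x ∈ K ∩ S, 0 ≤ inner ℝ z (f x) → m ≤ inner ℝ z (f x))
    (hu : IsArc f K S T u) (hv : IsArc f K S T' v) {D : ℝ}
    (hD : ‖v T - u T‖ ≤ D) (hsmall : ‖z‖ * (L * (1 + L * (2 * ‖z‖ / m))) * D ≤ m / 2) :
    T' - T ≤ 2 * ‖z‖ / m * D := by
  by_contra! hlt
  have hL := zero_le_one.trans H.one_le
  have hD0 : 0 ≤ D := (norm_nonneg _).trans hD
  set t := 2 * ‖z‖ / m * D with ht
  have ht0 : 0 ≤ t := by positivity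
  have d1 := hv.norm_sub_smul_le H hu.pos.le (le_add_of_nonneg_right ht0) (by linarith)
    hu.mem_end
  rw [add_sub_cancel_left] at d1
  have d2 := hside _ ⟨hv.mem (T + t) ⟨by linarith [hu.pos], by linarith⟩,
    hv.notMem _ ⟨by linarith [hu.pos], by linarith⟩⟩
  have d3 := hfm _ ⟨hu.mem_end, hu.hit⟩ (hu.inner_end_nonneg H hS hside)
  have d4 := (neg_le_abs _).trans (abs_real_inner_le_norm z (v (T + t) - v T - t • f (u T)))
  have d5 := (neg_le_abs _).trans (abs_real_inner_le_norm z (v T - u T))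
  rw [inner_sub_right, inner_sub_right, inner_smul_right] at d4
  rw [inner_sub_right, (hS _).1 hu.hit] at d5
  have d6 : ‖z‖ * ‖v (T + t) - v T - t • f (u T)‖ ≤ m / 2 * t := by
    calc _ ≤ ‖z‖ * (L * (D + L * t) * t) := by gcongr; exact d1.trans (by gcongr)
      _ = ‖z‖ * (L * (1 + L * (2 * ‖z‖ / m))) * D * t := by rw [ht]; ring
      _ ≤ m / 2 * t := by gcongr
  have d7 : ‖z‖ * ‖v T - u T‖ ≤ ‖z‖ * D := by gcongr
  have d8 : m * t = 2 * (‖z‖ * D) := by rw [ht]; field_simp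
  nlinarith [mul_le_mul_of_nonneg_right d3 ht0]

end Arcs

/-! ### Decay of the transverse energy -/

section TransverseEnergy

variable {E : Type*} [NormedAddCommGroup E] [InnerProductSpace ℝ E]
  {f g : E → E} {M : E → E →L[ℝ] E →L[ℝ] ℝ} {K S : Set E} {L T T' r D : ℝ} {u v : ℝ → E}

theorem UniformBounds.metric_nonneg (H : UniformBounds f g M K L) {x : E} (hx : x ∈ K) (v : E) :
    0 ≤ M x v v :=
  nonneg_of_mul_nonneg_right ((sq_nonneg _).trans (H.sq_norm_le x hx v))
    (zero_lt_one.trans_le H.one_le)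

theorem UniformBounds.abs_metric_le (H : UniformBounds f g M K L) {x : E} (hx : x ∈ K) (v w : E) :
    |M x v w| ≤ L * ‖v‖ * ‖w‖ :=
  ((M x).le_opNorm₂ v w).trans (by gcongr; exact H.norm_metric x hx)

/-- Grönwall's inequality for a decaying quantity with a constant perturbation. -/
theorem le_exp_mul_add_of_deriv_right_le {W W' : ℝ → ℝ} {k ε : ℝ} (hk : 0 < k) (hε : 0 ≤ ε)
    (hT : 0 ≤ T) (hW : ContinuousOn W (Icc 0 T))
    (hW' : ∀ t ∈ Ico 0 T, HasDerivWithinAt W (W' t) (Ici t) t)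
    (hle : ∀ t ∈ Ico 0 T, W' t ≤ -k * W t + ε) : W T ≤ Real.exp (-k * T) * W 0 + ε / k := by
  have key := image_le_of_deriv_right_le_deriv_boundary
    (f := fun t => Real.exp (k * t) * (W t - ε / k))
    (f' := fun t => Real.exp (k * t) * k * (W t - ε / k) + Real.exp (k * t) * W' t)
    (B := fun _ => W 0 - ε / k) (B' := fun _ => 0) (a := 0) (b := T)
    ((by fun_prop : Continuous fun t : ℝ => Real.exp (k * t)).continuousOn.mul
      (hW.sub continuousOn_const))
    (fun t ht => by
      have h1 : HasDerivAt (fun t : ℝ => Real.exp (k * t)) (Real.exp (k * t) * k) t := by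
        simpa using ((hasDerivAt_id t).const_mul k).exp
      exact h1.hasDerivWithinAt.mul ((hW' t ht).sub_const _))
    (by simp) continuousOn_const (fun t _ => hasDerivWithinAt_const _ _ _)
    (fun t ht => by
      have h1 : k * (W t - ε / k) + W' t ≤ 0 := by
        have := hle t ht
        have h2 : k * (ε / k) = ε := by field_simp
        linarith
      nlinarith [Real.exp_pos (k * t)])
    (x := T) ⟨hT, le_rfl⟩
  have h1 : 0 < Real.exp (-k * T) := Real.exp_pos _
  have h2 : Real.exp (-k * T) * Real.exp (k * T) = 1 := by
    rw [← Real.exp_add]; simp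
  have h3 := mul_le_mul_of_nonneg_left key h1.le
  rw [← mul_assoc, h2] at h3
  have h4 : 0 ≤ ε / k := by positivity
  nlinarith

/-- Along two neighbouring arcs `u`, `v` run at their natural speed, the squared `M`-length of the
component of `v - u` that is `M`-orthogonal to the flow decays at rate `2 r`, up to an error of
third order in the distance `D` of the arcs. Here `θ • f (u T)` is the component along the flow. -/
theorem IsArc.exists_transverse_energy_le (H : UniformBounds f g M K L)
    (hf : ∀ x ∈ K, HasFDerivAt f (fderiv ℝ f x) x) (hM : ∀ x ∈ K, HasFDerivAt M (fderiv ℝ M x) x)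
    (hsymm : ∀ x ∈ K, ∀ v w, M x v w = M x w v) (hf0 : ∀ x ∈ K, f x ≠ 0) (hr : 0 < r)
    (hcontr : ∀ x ∈ K, ∀ w, M x (f x) w = 0 →
      fderiv ℝ M x (f x) w w + 2 * M x w (fderiv ℝ f x w) ≤ -(2 * r) * M x w w)
    (hu : IsArc f K S T u) (hv : IsArc f K S T' v) (hTT : T ≤ T')
    (hD : ∀ t ∈ Icc 0 T, ‖v t - u t‖ ≤ D) :
    ∃ θ : ℝ, M (u T) (f (u T)) (v T - u T - θ • f (u T)) = 0 ∧
      M (u T) (v T - u T - θ • f (u T)) (v T - u T - θ • f (u T)) ≤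
        Real.exp (-(2 * r) * T) * M (u 0) (v 0 - u 0) (v 0 - u 0) + L ^ 3 / r * D ^ 3 := by
  have hL := zero_lt_one.trans_le H.one_le
  have hD0 : 0 ≤ D := (norm_nonneg _).trans (hD 0 ⟨le_rfl, hu.pos.le⟩)
  have hff : ∀ x ∈ K, 0 < M x (f x) (f x) := fun x hx => by
    refine pos_of_mul_pos_right (lt_of_lt_of_le ?_ (H.sq_norm_le x hx (f x))) hL.le
    exact pow_pos (norm_pos_iff.2 (hf0 x hx)) 2
  set θ : ℝ → ℝ := fun t => M (u t) (f (u t)) (v t - u t) / M (u t) (f (u t)) (f (u t)) with hθ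
  set N : ℝ → E := fun t => v t - u t - θ t • f (u t) with hN
  have horth : ∀ t ∈ Icc 0 T, M (u t) (f (u t)) (N t) = 0 := fun t ht => by
    have := (hff _ (hu.mem t ht)).ne'
    simp only [hN, hθ, map_sub, map_smul, smul_eq_mul]
    field_simp
    ring
  have hNle : ∀ t ∈ Icc 0 T, M (u t) (N t) (N t) ≤ M (u t) (v t - u t) (v t - u t) := by
    intro t ht
    have hx := hu.mem t ht
    have h1 := horth t ht
    have h2 : v t - u t = N t + θ t • f (u t) := by simp [hN]
    have h3 := mul_nonneg (sq_nonneg (θ t)) (hff _ hx).le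
    rw [h2]
    simp only [map_add, map_smul, add_apply, smul_apply, smul_eq_mul,
      hsymm _ hx (N t) (f (u t)), h1]
    nlinarith
  have hNn : ∀ t ∈ Icc 0 T, ‖N t‖ ≤ L * D := fun t ht => by
    have hx := hu.mem t ht
    refine abs_le_of_sq_le_sq' ?_ (by positivity) |>.2
    calc ‖N t‖ ^ 2 ≤ L * M (u t) (N t) (N t) := H.sq_norm_le _ hx _
      _ ≤ L * (L * ‖v t - u t‖ * ‖v t - u t‖) := by
        gcongr
        exact (hNle t ht).trans ((le_abs_self _).trans (H.abs_metric_le hx _ _))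
      _ ≤ L * (L * D * D) := by gcongr <;> exact hD t ht
      _ = (L * D) ^ 2 := by ring
  have hvc : ContinuousOn v (Icc 0 T) := hv.cont.mono (Icc_subset_Icc le_rfl hTT)
  have hfc : ContinuousOn (fun t => f (u t)) (Icc 0 T) := fun t ht =>
    (hf _ (hu.mem t ht)).continuousAt.comp_continuousWithinAt (hu.cont t ht)
  have hMc : ContinuousOn (fun t => M (u t)) (Icc 0 T) := fun t ht =>
    (hM _ (hu.mem t ht)).continuousAt.comp_continuousWithinAt (hu.cont t ht)
  have hθc : ContinuousOn θ (Icc 0 T) :=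
    ((hMc.clm_apply hfc).clm_apply (hvc.sub hu.cont)).div ((hMc.clm_apply hfc).clm_apply hfc)
      fun t ht => (hff _ (hu.mem t ht)).ne'
  have hNc : ContinuousOn N (Icc 0 T) := (hvc.sub hu.cont).sub (hθc.smul hfc)
  have hW' : ∀ t ∈ Ico 0 T, ∃ W' : ℝ,
      HasDerivWithinAt (fun t => M (u t) (N t) (N t)) W' (Ici t) t ∧
        W' ≤ -(2 * r) * M (u t) (N t) (N t) + 2 * L ^ 3 * D ^ 3 := by
    intro t ht
    have ht' : t ∈ Icc 0 T := ⟨ht.1, ht.2.le⟩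
    have hx := hu.mem t ht'
    have hy := hv.mem t ⟨ht.1, (ht.2.trans_le hTT).le⟩
    have du := hu.deriv t ht
    have dv := hv.deriv t ⟨ht.1, ht.2.trans_le hTT⟩
    have df := (hf _ hx).comp_hasDerivWithinAt t du
    have dM : HasDerivWithinAt (fun t => M (u t)) (fderiv ℝ M (u t) (f (u t))) (Ici t) t :=
      HasFDerivAt.comp_hasDerivWithinAt (E := E →L[ℝ] E →L[ℝ] ℝ) (l := M) t (hM _ hx) du
    -- only the existence of the derivative of `θ` matters: its value is multiplied by `M f N = 0`
    obtain ⟨θ', dθ⟩ : ∃ θ', HasDerivWithinAt θ θ' (Ici t) t :=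
      ⟨_, ((dM.clm_apply df).clm_apply (dv.sub du)).div ((dM.clm_apply df).clm_apply df)
        (hff _ hx).ne'⟩
    have dN := (dv.sub du).sub (dθ.smul df)
    refine ⟨_, (dM.clm_apply dN).clm_apply dN, ?_⟩
    set R := f (v t) - f (u t) - fderiv ℝ f (u t) (v t - u t) with hR
    have hRn : ‖R‖ ≤ L * D ^ 2 := (H.taylor_field _ hx _ hy).trans (by
      gcongr; exact hD t ht')
    have hN' : f (v t) - f (u t) - (θ t • fderiv ℝ f (u t) (f (u t)) + θ' • f (u t)) =
        fderiv ℝ f (u t) (N t) + R - θ' • f (u t) := by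
      simp only [hN, hR, map_sub, map_smul]
      abel
    have h1 := horth t ht'
    have h2 := hcontr _ hx (N t) h1
    have h3 : M (u t) (N t) R ≤ L * (L * D) * (L * D ^ 2) :=
      (le_abs_self _).trans ((H.abs_metric_le hx _ _).trans (by gcongr; exact hNn t ht'))
    have h4 : M (u t) (N t) (f (u t)) = 0 := by rw [hsymm _ hx, h1]
    change (fderiv ℝ M (u t) (f (u t)) (N t) +
      M (u t) (f (v t) - f (u t) - (θ t • fderiv ℝ f (u t) (f (u t)) + θ' • f (u t)))) (N t) +
      M (u t) (N t)
        (f (v t) - f (u t) - (θ t • fderiv ℝ f (u t) (f (u t)) + θ' • f (u t))) ≤ _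
    rw [hN', add_apply, hsymm _ hx _ (N t)]
    simp only [map_add, map_sub, map_smul, h4, smul_zero, sub_zero]
    nlinarith
  choose! W' hd hle using hW'
  have key := le_exp_mul_add_of_deriv_right_le (W := fun t => M (u t) (N t) (N t))
    (k := 2 * r) (ε := 2 * L ^ 3 * D ^ 3) (by positivity) (by positivity) hu.pos.le
    ((hMc.clm_apply hNc).clm_apply hNc) hd hle
  refine ⟨θ T, horth T ⟨hu.pos.le, le_rfl⟩, key.trans ?_⟩
  have h1 : 2 * L ^ 3 * D ^ 3 / (2 * r) = L ^ 3 / r * D ^ 3 := by field_simp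
  rw [h1]
  gcongr
  exact hNle 0 ⟨le_rfl, hu.pos.le⟩

end TransverseEnergy

/-! ### Contraction from one impulse to the next -/

section Step

variable {E : Type*} [NormedAddCommGroup E] [InnerProductSpace ℝ E]
  {f g : E → E} {M : E → E →L[ℝ] E →L[ℝ] ℝ} {K S : Set E} {z : E} {b r L m : ℝ}

/-- The hypotheses on the hybrid system in the form in which they are used: quantitative bounds
with constants `L` (sizes and Lipschitz constants on `K`) and `m` (normal speed at the impacts),
transverse contraction with the square root of the metric differentiated away, and `K` lying on the
side `⟪z, x⟫ ≤ b` of the surface `S`. -/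
structure ContractingTube (f g : E → E) (M : E → E →L[ℝ] E →L[ℝ] ℝ) (K S : Set E) (z : E)
    (b r L m : ℝ) : Prop where
  bounds : UniformBounds f g M K L
  field_hasFDerivAt : ∀ x ∈ K, HasFDerivAt f (fderiv ℝ f x) x
  metric_hasFDerivAt : ∀ x ∈ K, HasFDerivAt M (fderiv ℝ M x) x
  symm : ∀ x ∈ K, ∀ v w, M x v w = M x w v
  field_ne_zero : ∀ x ∈ K, f x ≠ 0
  rate_pos : 0 < r
  contracting : ∀ x ∈ K, ∀ w, M x (f x) w = 0 →
    fderiv ℝ M x (f x) w w + 2 * M x w (fderiv ℝ f x w) ≤ -(2 * r) * M x w w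
  mem_surface : ∀ x, x ∈ S ↔ inner ℝ z x = b
  inner_lt : ∀ x ∈ K \ S, inner ℝ z x < b
  speed_pos : 0 < m
  le_speed : ∀ x ∈ K ∩ S, 0 ≤ inner ℝ z (f x) → m ≤ inner ℝ z (f x)
  orthogonal : ∀ x ∈ K ∩ S, ∀ w, inner ℝ z w = 0 → M x (f x) w = 0
  jump_le : ∀ x ∈ K ∩ S, ∀ w, M x w (f x) = 0 →
    M (g x) (fderiv ℝ g x w) (fderiv ℝ g x w) ≤ M x w w
  jump_mem : ∀ x ∈ K ∩ S, g x ∈ K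

/-- The squared length of `y - x` measured with the metric at `x`. -/
noncomputable def localEnergy (M : E → E →L[ℝ] E →L[ℝ] ℝ) (x y : E) : ℝ := M x (y - x) (y - x)

theorem UniformBounds.localEnergy_le (H : UniformBounds f g M K L) {x y : E} (hx : x ∈ K) :
    localEnergy M x y ≤ L * ‖y - x‖ ^ 2 := by
  refine (le_abs_self _).trans ((H.abs_metric_le hx _ _).trans (le_of_eq ?_))
  ring

theorem UniformBounds.localEnergy_swap_le (H : UniformBounds f g M K L) {x y : E} (hx : x ∈ K)
    (hy : y ∈ K) : localEnergy M y x ≤ localEnergy M x y + L * ‖y - x‖ ^ 3 := by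
  have h1 : localEnergy M y x = localEnergy M x y + (M y - M x) (y - x) (y - x) := by
    have h : x - y = -(y - x) := by abel
    simp only [localEnergy, h, map_neg, neg_apply, sub_apply, neg_neg]
    ring
  have h2 : (M y - M x) (y - x) (y - x) ≤ L * ‖y - x‖ * ‖y - x‖ * ‖y - x‖ :=
    (le_abs_self _).trans (((M y - M x).le_opNorm₂ _ _).trans (by
      gcongr; exact H.lip_metric x hx y hy))
  rw [h1]
  linarith

namespace ContractingTube

/-- The projection along `f p` onto the orthogonal complement of `f p` does not increase the energy;
`R` is an error term. -/
theorem metric_le_of_orthogonal (h : ContractingTube f g M K S z b r L m) {p w N R : E} {β : ℝ}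
    (hp : p ∈ K) (hwf : M p (f p) w = 0) (hw : w = N + R + β • f p) :
    M p w w ≤ M p N N + 2 * (L * ‖w‖ * ‖R‖) := by
  have h2 : M p w w = M p w N + M p w R := by
    calc M p w w = M p w (N + R + β • f p) := congrArg (M p w) hw
      _ = _ := by
        rw [map_add, map_add, map_smul, h.symm _ hp w (f p), hwf, smul_zero, add_zero]
  have h3 := h.bounds.metric_nonneg hp (w - N)
  simp only [map_sub, sub_apply, h.symm _ hp N w] at h3
  have h4 := (le_abs_self _).trans (h.bounds.abs_metric_le hp w R)
  linarith

/-- The impulse does not increase the energy of two impact points, up to third order. -/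
theorem localEnergy_jump_le (h : ContractingTube f g M K S z b r L m) {p q : E}
    (hp : p ∈ K ∩ S) (hq : q ∈ K ∩ S) :
    localEnergy M (g p) (g q) ≤ localEnergy M p q + 2 * L ^ 3 * ‖q - p‖ ^ 3 := by
  have H := h.bounds
  have hL := zero_lt_one.trans_le H.one_le
  have hgp := h.jump_mem _ hp
  -- the segment between impact points is tangent to the flat surface `S`
  have hwf : M p (f p) (q - p) = 0 := h.orthogonal _ hp _ (by
    rw [inner_sub_right, (h.mem_surface _).1 hq.2, (h.mem_surface _).1 hp.2, sub_self])
  have hgw := h.jump_le _ hp (q - p) (by rw [h.symm _ hp.1, hwf])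
  obtain ⟨P, hP⟩ : ∃ P, P = g q - g p - fderiv ℝ g p (q - p) := ⟨_, rfl⟩
  have h1 : ‖P‖ ≤ L * ‖q - p‖ ^ 2 := hP ▸ H.taylor_jump _ hp.1 _ hq.1
  have h2 : ‖g q - g p‖ ≤ L * ‖q - p‖ := H.lip_jump _ hp.1 _ hq.1
  have h3 : fderiv ℝ g p (q - p) = (g q - g p) - P := by rw [hP]; abel
  unfold localEnergy
  generalize g q - g p = Δ at *
  simp only [h3, map_sub (M (g p)), map_sub (M (g p) _), sub_apply, h.symm _ hgp P Δ] at hgw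
  have h4 := H.metric_nonneg hgp P
  have h5 : M (g p) Δ P ≤ L * (L * ‖q - p‖) * (L * ‖q - p‖ ^ 2) :=
    (le_abs_self _).trans ((H.abs_metric_le hgp _ _).trans (by gcongr))
  linarith

/-- If the arc `u` has its impact first, a neighbouring arc `v` stays close to `u` at proportional
times, and the energy of the two states after the impulses is at most `exp (-2 r T)` times the
initial one, up to an error of third order. -/
theorem exists_step (h : ContractingTube f g M K S z b r L m) (Tmax : ℝ) :
    ∃ C ≥ 0, ∃ ε > 0, ∀ T T' u v, IsArc f K S T u → IsArc f K S T' v → T ≤ T' → T ≤ Tmax →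
      ‖v 0 - u 0‖ ≤ ε →
      (∀ c ∈ Icc (0 : ℝ) 1, ‖v (c * T') - u (c * T)‖ ≤ C * ‖v 0 - u 0‖) ∧
      localEnergy M (g (u T)) (g (v T')) ≤
        Real.exp (-(2 * r) * T) * localEnergy M (u 0) (v 0) + C * ‖v 0 - u 0‖ ^ 3 := by
  have H := h.bounds
  have hL := zero_lt_one.trans_le H.one_le
  have hm := h.speed_pos
  have hr := h.rate_pos
  obtain ⟨e, he⟩ : ∃ e, e = Real.exp (L * Tmax) := ⟨_, rfl⟩
  have he0 : 0 < e := he ▸ Real.exp_pos _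
  obtain ⟨C₁, hC₁⟩ : ∃ C₁, C₁ = 2 * ‖z‖ / m := ⟨_, rfl⟩
  have hC₁0 : 0 ≤ C₁ := by rw [hC₁]; positivity
  obtain ⟨Q, hQ⟩ : ∃ Q, Q = ‖z‖ * (L * (1 + L * C₁)) := ⟨_, rfl⟩
  have hQ0 : 0 ≤ Q := by rw [hQ]; positivity
  obtain ⟨C₂, hC₂⟩ : ∃ C₂, C₂ = 1 + L * C₁ := ⟨_, rfl⟩
  have hC₂0 : 0 ≤ C₂ := by rw [hC₂]; positivity
  obtain ⟨C₃, hC₃⟩ : ∃ C₃, C₃ = L ^ 3 / r + 2 * (L * C₂ * (L * C₁ * C₂)) + 2 * L ^ 3 * C₂ ^ 3 :=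
    ⟨_, rfl⟩
  have hC₃0 : 0 ≤ C₃ := by rw [hC₃]; positivity
  refine ⟨C₁ * e + C₂ * e + C₃ * e ^ 3, by positivity, m / (2 * (Q + 1) * e), by positivity, ?_⟩
  intro T T' u v hu hv hTT hTm hd
  obtain ⟨d, hdd⟩ : ∃ d, d = ‖v 0 - u 0‖ := ⟨_, rfl⟩
  rw [← hdd] at hd ⊢
  have hd0 : 0 ≤ d := hdd ▸ norm_nonneg _
  obtain ⟨D, hDd⟩ : ∃ D, D = e * d := ⟨_, rfl⟩
  have hD0 : 0 ≤ D := by rw [hDd]; positivity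
  have hsep : ∀ t ∈ Icc 0 T, ‖v t - u t‖ ≤ D := fun t ht => by
    refine (hu.norm_sub_le_exp H hv hTT ht).trans ?_
    rw [hDd, mul_comm, ← hdd, he]
    gcongr
    exact ht.2.trans hTm
  have hTI : T ∈ Icc 0 T := ⟨hu.pos.le, le_rfl⟩
  have hsmall : Q * D ≤ m / 2 := by
    have h1 : D ≤ m / (2 * (Q + 1)) := by
      calc D = e * d := hDd
        _ ≤ e * (m / (2 * (Q + 1) * e)) := by gcongr
        _ = m / (2 * (Q + 1)) := by field_simp
    calc Q * D ≤ (Q + 1) * (m / (2 * (Q + 1))) := by gcongr; linarith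
      _ = m / 2 := by field_simp
  have hdT : T' - T ≤ C₁ * D := by
    rw [hQ, hC₁] at hsmall
    rw [hC₁]
    exact hu.sub_le_of_norm_sub_le H h.mem_surface h.inner_lt hm h.le_speed hv (hsep T hTI) hsmall
  have hTT0 : 0 ≤ T' - T := sub_nonneg.2 hTT
  have hpK := hu.mem_end
  have hpS : u T ∈ K ∩ S := ⟨hpK, hu.hit⟩
  have hqS : v T' ∈ K ∩ S := ⟨hv.mem_end, hv.hit⟩
  have hprop : ∀ c ∈ Icc (0 : ℝ) 1, ‖v (c * T') - u (c * T)‖ ≤ C₂ * D := fun c hc => by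
    have hcT : c * T ≤ T := mul_le_of_le_one_left hu.pos.le hc.2
    have hcT0 : 0 ≤ c * T := mul_nonneg hc.1 hu.pos.le
    have h1 := hsep (c * T) ⟨hcT0, hcT⟩
    have h2 := hv.norm_sub_le H hcT0 (mul_le_mul_of_nonneg_left hTT hc.1)
      (mul_le_of_le_one_left hv.pos.le hc.2)
    have h3 : c * T' - c * T ≤ C₁ * D := by
      rw [← mul_sub]; exact (mul_le_of_le_one_left hTT0 hc.2).trans hdT
    have h4 : L * (c * T' - c * T) ≤ L * (C₁ * D) := by gcongr
    have h5 := norm_sub_le_norm_sub_add_norm_sub (v (c * T')) (v (c * T)) (u (c * T))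
    rw [hC₂]
    linarith
  have hw : ‖v T' - u T‖ ≤ C₂ * D := by simpa using hprop 1 (by simp)
  obtain ⟨θ, -, hE⟩ := hu.exists_transverse_energy_le H h.field_hasFDerivAt
    h.metric_hasFDerivAt h.symm h.field_ne_zero hr h.contracting hv hTT hsep
  -- the final stretch of `v` is parallel to the flow at `u T`, up to second order
  have hR : ‖v T' - v T - (T' - T) • f (u T)‖ ≤ L * C₁ * C₂ * D ^ 2 := by
    refine (hv.norm_sub_smul_le H hu.pos.le hTT le_rfl hpK).trans ?_
    calc L * (‖v T - u T‖ + L * (T' - T)) * (T' - T) ≤ L * (D + L * (C₁ * D)) * (C₁ * D) := by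
          gcongr; exact hsep T hTI
      _ = L * C₁ * C₂ * D ^ 2 := by rw [hC₂]; ring
  have hwf : M (u T) (f (u T)) (v T' - u T) = 0 := h.orthogonal _ hpS _ (by
    rw [inner_sub_right, (h.mem_surface _).1 hqS.2, (h.mem_surface _).1 hpS.2, sub_self])
  have hww := h.metric_le_of_orthogonal (N := v T - u T - θ • f (u T))
    (R := v T' - v T - (T' - T) • f (u T)) (β := θ + (T' - T)) hpK hwf
    (by rw [add_smul]; abel)
  have hwR : L * ‖v T' - u T‖ * ‖v T' - v T - (T' - T) • f (u T)‖ ≤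
      L * (C₂ * D) * (L * C₁ * C₂ * D ^ 2) := by gcongr
  have hΔ := h.localEnergy_jump_le hpS hqS
  have hw3 : 2 * L ^ 3 * ‖v T' - u T‖ ^ 3 ≤ 2 * L ^ 3 * (C₂ * D) ^ 3 := by gcongr
  have hrest1 : 0 ≤ C₁ * e * d := by positivity
  have hrest3 : 0 ≤ C₃ * e ^ 3 * d := by positivity
  refine ⟨fun c hc => ?_, ?_⟩
  · have := hprop c hc
    rw [hDd] at this
    linarith
  · have h1 : C₃ * D ^ 3 = C₃ * e ^ 3 * d ^ 3 := by rw [hDd]; ring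
    have h2 : 0 ≤ (C₁ * e + C₂ * e) * d ^ 3 := by positivity
    have h3 : C₃ * D ^ 3 = L ^ 3 / r * D ^ 3 + 2 * (L * (C₂ * D) * (L * C₁ * C₂ * D ^ 2)) +
      2 * L ^ 3 * (C₂ * D) ^ 3 := by rw [hC₃]; ring
    unfold localEnergy at hΔ ⊢
    linarith

/-- Neighbouring arcs with durations in a fixed compact subinterval of `(0, ∞)` stay close when run
at proportional times, and the energy contracts by a fixed factor from one impulse to the next. -/
theorem exists_contraction (h : ContractingTube f g M K S z b r L m) {Tmin : ℝ} (hTmin : 0 < Tmin)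
    (Tmax : ℝ) :
    ∃ C ≥ 0, ∃ κ ∈ Ico (0 : ℝ) 1, ∃ ε > 0, ∀ T T' u v, IsArc f K S T u → IsArc f K S T' v →
      T ∈ Icc Tmin Tmax → T' ∈ Icc Tmin Tmax → ‖v 0 - u 0‖ ≤ ε →
      (∀ c ∈ Icc (0 : ℝ) 1, ‖v (c * T') - u (c * T)‖ ≤ C * ‖v 0 - u 0‖) ∧
      localEnergy M (g (u T)) (g (v T')) ≤ κ * localEnergy M (u 0) (v 0) := by
  have H := h.bounds
  have hL := zero_lt_one.trans_le H.one_le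
  obtain ⟨C, hC, ε, hε, hstep⟩ := h.exists_step Tmax
  set q := Real.exp (-(2 * r) * Tmin) with hq
  have hq0 : 0 < q := Real.exp_pos _
  have hq1 : q < 1 := by
    rw [hq, Real.exp_lt_one_iff]
    have := mul_pos h.rate_pos hTmin
    linarith
  have hqle : ∀ T ∈ Icc Tmin Tmax, Real.exp (-(2 * r) * T) ≤ q := fun T hT => by
    rw [hq, Real.exp_le_exp]
    nlinarith [hT.1, h.rate_pos]
  -- the error constant, including the cost of exchanging the roles of the two arcs
  set C' := C + L + L * (L * C) ^ 3 with hC'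
  have hC'0 : 0 ≤ C' := by positivity
  refine ⟨C, hC, (1 + q) / 2, ⟨by positivity, by linarith⟩,
    min ε ((1 - q) / (2 * (C' * L + 1))), lt_min hε (by
      have : 0 < 1 - q := by linarith
      positivity), ?_⟩
  intro T T' u v hu hv hT hT' hd
  have hd1 := hd.trans (min_le_left _ _)
  have hd2 := hd.trans (min_le_right _ _)
  set d := ‖v 0 - u 0‖ with hdd
  have hd0 : 0 ≤ d := norm_nonneg _
  have hE0 : 0 ≤ localEnergy M (u 0) (v 0) := H.metric_nonneg hu.mem_start _
  have key : (∀ c ∈ Icc (0 : ℝ) 1, ‖v (c * T') - u (c * T)‖ ≤ C * d) ∧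
      localEnergy M (g (u T)) (g (v T')) ≤ q * localEnergy M (u 0) (v 0) + C' * d ^ 3 := by
    rcases le_total T T' with hle | hle
    · obtain ⟨h2, h3⟩ := hstep T T' u v hu hv hle hT.2 hd1
      refine ⟨h2, h3.trans ?_⟩
      gcongr
      · exact hqle T hT
      · rw [hC']; have : 0 ≤ L * (L * C) ^ 3 := by positivity
        linarith
    · have hsymm : ‖u 0 - v 0‖ = d := norm_sub_rev _ _
      obtain ⟨h2, h3⟩ := hstep T' T v u hv hu hle hT'.2 (hsymm.trans_le hd1)
      rw [hsymm] at h2 h3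
      have h2' : ∀ c ∈ Icc (0 : ℝ) 1, ‖v (c * T') - u (c * T)‖ ≤ C * d := fun c hc => by
        rw [norm_sub_rev]; exact h2 c hc
      refine ⟨h2', ?_⟩
      have hp : u T ∈ K ∩ S := ⟨hu.mem_end, hu.hit⟩
      have hq' : v T' ∈ K ∩ S := ⟨hv.mem_end, hv.hit⟩
      have h4 := H.localEnergy_swap_le (h.jump_mem _ hq') (h.jump_mem _ hp)
      have h5 := H.localEnergy_swap_le hu.mem_start hv.mem_start
      have h6 : ‖g (u T) - g (v T')‖ ≤ L * C * d := by
        refine (H.lip_jump _ hq'.1 _ hp.1).trans ?_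
        rw [mul_assoc]
        gcongr
        simpa using h2 1 (by simp)
      have h7 : L * ‖g (u T) - g (v T')‖ ^ 3 ≤ L * (L * C) ^ 3 * d ^ 3 := by
        rw [mul_assoc, ← mul_pow]; gcongr
      have h8 : Real.exp (-(2 * r) * T') * localEnergy M (v 0) (u 0) ≤
          q * localEnergy M (u 0) (v 0) + L * d ^ 3 := by
        calc _ ≤ q * localEnergy M (v 0) (u 0) := by
              gcongr
              · exact H.metric_nonneg hv.mem_start _
              · exact hqle T' hT'
          _ ≤ q * (localEnergy M (u 0) (v 0) + L * d ^ 3) := by gcongr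
          _ ≤ q * localEnergy M (u 0) (v 0) + L * d ^ 3 := by
              have : 0 ≤ L * d ^ 3 := by positivity
              nlinarith
      rw [hC']
      linarith
  refine ⟨key.1, key.2.trans ?_⟩
  have h1 : d ^ 2 ≤ L * localEnergy M (u 0) (v 0) := H.sq_norm_le _ hu.mem_start _
  have h2 : C' * L * d ≤ (1 - q) / 2 := by
    have h3 : 0 < 1 - q := by linarith
    calc C' * L * d ≤ (C' * L + 1) * ((1 - q) / (2 * (C' * L + 1))) := by gcongr; linarith
      _ = (1 - q) / 2 := by field_simp
  have h3 : C' * d ^ 3 ≤ (1 - q) / 2 * localEnergy M (u 0) (v 0) := by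
    calc C' * d ^ 3 = C' * d * d ^ 2 := by ring
      _ ≤ C' * d * (L * localEnergy M (u 0) (v 0)) := by gcongr
      _ = C' * L * d * localEnergy M (u 0) (v 0) := by ring
      _ ≤ _ := by gcongr
  linarith

end ContractingTube

end Step

/-! ### Decomposition of hybrid solutions into arcs -/

section HybridSolutions

variable {n : ℕ} {f g : EuclideanSpace ℝ (Fin n) → EuclideanSpace ℝ (Fin n)}
  {S K : Set (EuclideanSpace ℝ (Fin n))} {x₀ : EuclideanSpace ℝ (Fin n)}
  {x : ℝ → EuclideanSpace ℝ (Fin n)}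

theorem IsHybridSolution.continuousWithinAt (hx : IsHybridSolution f g S x₀ x) {t : ℝ}
    (ht : 0 ≤ t) : ContinuousWithinAt x (Ici t) t :=
  (hx.flow t ht).2.continuousWithinAt

theorem IsHybridSolution.shift (hx : IsHybridSolution f g S x₀ x) {t : ℝ} (ht : 0 ≤ t) :
    IsHybridSolution f g S (x t) (fun s => x (t + s)) where
  init_flow _ := by simp
  init_jump h := absurd h (hx.flow t ht).1
  flow s hs := by
    refine ⟨(hx.flow (t + s) (by positivity)).1, ?_⟩
    have h := (hx.flow (t + s) (by positivity)).2
    have h2 := h.scomp s (((hasDerivAt_id s).const_add t).hasDerivWithinAt (s := Ici s))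
      (fun r hr => add_le_add_right (mem_Ici.1 hr) t)
    rw [one_smul] at h2
    exact h2
  flow_or_jump s hs := by
    rcases hx.flow_or_jump (t + s) (by positivity) with h | ⟨p, hp, hlim, hjump⟩
    · exact Or.inl (h.comp_const_add t s)
    · refine Or.inr ⟨p, hp, hlim.comp ?_, hjump⟩
      refine tendsto_nhdsWithin_of_tendsto_nhds_of_eventually_within _ ?_ ?_
      · exact ((continuous_const.add continuous_id).tendsto s).mono_left nhdsWithin_le_nhds
      · filter_upwards [self_mem_nhdsWithin] with r hr
        exact add_lt_add_right hr t

theorem StrictlyForwardInvariant.mem (hinv : StrictlyForwardInvariant f g S K)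
    (hK : IsClosed K) (hx₀ : x₀ ∈ K) (hx : IsHybridSolution f g S x₀ x) {t : ℝ} (ht : 0 ≤ t) :
    x t ∈ K := by
  rcases ht.eq_or_lt with rfl | ht'
  · refine hK.mem_of_tendsto
      ((hx.continuousWithinAt le_rfl).mono_left (nhdsWithin_mono _ Ioi_subset_Ici_self)) ?_
    filter_upwards [self_mem_nhdsWithin] with s hs
    exact interior_subset ((hinv x₀ hx₀).2 x hx s hs)
  · exact interior_subset ((hinv x₀ hx₀).2 x hx t ht')

/-- There is no impact immediately after a given time, since hybrid solutions are right-continuous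
and off the surface. In particular impacts do not accumulate. -/
theorem IsHybridSolution.eventually_no_impact (hS : IsClosed S)
    (hx : IsHybridSolution f g S x₀ x) {t : ℝ} (ht : 0 ≤ t) :
    ∀ᶠ s in 𝓝[>] t, ¬ ∃ p ∈ S, Tendsto x (𝓝[<] s) (𝓝 p) := by
  obtain ⟨C, hC, hCc, hCS⟩ :=
    exists_mem_nhds_isClosed_subset (hS.isOpen_compl.mem_nhds (hx.flow t ht).1)
  have h1 : ∀ᶠ s in 𝓝[>] t, x s ∈ C :=
    ((hx.continuousWithinAt ht).mono_left (nhdsWithin_mono _ Ioi_subset_Ici_self)).eventually hC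
  obtain ⟨w, hw, hsub⟩ := mem_nhdsGT_iff_exists_Ioo_subset.1 h1
  filter_upwards [Ioo_mem_nhdsGT hw] with s hs
  rintro ⟨p, hp, hlim⟩
  refine hCS (hCc.mem_of_tendsto hlim ?_) hp
  filter_upwards [Ioo_mem_nhdsLT hs.1] with r hr
  exact hsub ⟨hr.1, hr.2.trans hs.2⟩

/-- A hybrid solution that reaches the surface starts with an arc, followed by an impulse. -/
theorem IsHybridSolution.exists_isArc (hS : IsClosed S) (hK : IsClosed K)
    (hx : IsHybridSolution f g S x₀ x) (hxK : ∀ t, 0 ≤ t → x t ∈ K) (hreach : ReachesSurface S x) :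
    ∃ T u, IsArc f K S T u ∧ (∀ s ∈ Ico 0 T, u s = x s) ∧ x T = g (u T) := by
  set I : Set ℝ := {t | 0 < t ∧ ∃ p ∈ S, Tendsto x (𝓝[<] t) (𝓝 p)} with hI
  have hIne : I.Nonempty := hreach
  have hIb : BddBelow I := ⟨0, fun t ht => ht.1.le⟩
  obtain ⟨T, hTdef⟩ : ∃ T, T = sInf I := ⟨_, rfl⟩
  have hT0 : 0 ≤ T := hTdef ▸ le_csInf hIne fun t ht => ht.1.le
  have hTI : T ∈ I := by
    by_contra hnot
    obtain ⟨w, hw, hsub⟩ :=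
      mem_nhdsGT_iff_exists_Ioo_subset.1 (hx.eventually_no_impact hS hT0)
    obtain ⟨t, htI, htw⟩ := exists_lt_of_csInf_lt hIne (hTdef ▸ hw : sInf I < w)
    have hTt : T ≤ t := hTdef ▸ csInf_le hIb htI
    exact hsub ⟨lt_of_le_of_ne hTt fun h => hnot (h ▸ htI), htw⟩ htI.2
  obtain ⟨hTpos, p, hp, hlim⟩ := hTI
  have hflow : ∀ s, 0 < s → s < T → HasDerivAt x (f (x s)) s := fun s hs hsT => by
    rcases hx.flow_or_jump s hs with h | ⟨q, hq, hq', -⟩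
    · exact h
    · exact absurd (hTdef ▸ csInf_le hIb (⟨hs, q, hq, hq'⟩ : s ∈ I)) (not_le.2 hsT)
  have hpK : p ∈ K := by
    refine hK.mem_of_tendsto hlim ?_
    filter_upwards [Ioo_mem_nhdsLT hTpos] with s hs using hxK s hs.1.le
  have hxT : x T = g p := by
    rcases hx.flow_or_jump T hTpos with h | ⟨q, -, hq', hqj⟩
    · have := tendsto_nhds_unique hlim (h.continuousAt.tendsto.mono_left nhdsWithin_le_nhds)
      exact absurd (this ▸ hp) (hx.flow T hT0).1
    · rw [hqj, tendsto_nhds_unique hlim hq']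
  have hu : ∀ s, s < T → Function.update x T p s = x s := fun s hs =>
    Function.update_of_ne hs.ne _ _
  have huT : Function.update x T p T = p := Function.update_self _ _ _
  have hev : ∀ s, s < T → Function.update x T p =ᶠ[𝓝 s] x := fun s hs => by
    filter_upwards [Iio_mem_nhds hs] with r hr using hu r hr
  refine ⟨T, Function.update x T p, ⟨hTpos, ?_, ?_, ?_, ?_, by rwa [huT]⟩, fun s hs => hu s hs.2,
    by rw [huT, hxT]⟩
  · rintro s ⟨hs0, hsT⟩
    rcases hsT.eq_or_lt with rfl | hsT
    · rw [continuousWithinAt_update_same]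
      exact hlim.mono_left (nhdsWithin_mono _ fun r hr => lt_of_le_of_ne hr.1.2 hr.2)
    · have h1 : ContinuousWithinAt x (Icc 0 T) s := by
        rcases hs0.eq_or_lt with rfl | hs0
        · exact (hx.continuousWithinAt le_rfl).mono Icc_subset_Ici_self
        · exact (hflow s hs0 hsT).continuousAt.continuousWithinAt
      exact h1.congr_of_eventuallyEq ((hev s hsT).filter_mono nhdsWithin_le_nhds) (hu s hsT)
  · rintro s ⟨hs0, hsT⟩
    rw [hu s hsT]
    exact (hx.flow s hs0).2.congr_of_eventuallyEq
      ((hev s hsT).filter_mono nhdsWithin_le_nhds) (hu s hsT)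
  · rintro s ⟨hs0, hsT⟩
    rcases hsT.eq_or_lt with rfl | hsT
    · rwa [huT]
    · rw [hu s hsT]; exact hxK s hs0
  · rintro s ⟨hs0, hsT⟩
    rw [hu s hsT]; exact (hx.flow s hs0).1

/-- The decomposition of the curve `x` into the arcs `u k`, of duration `T k` and starting at the
time `t k`, between its consecutive impacts. -/
structure IsArcDecomposition (f g : EuclideanSpace ℝ (Fin n) → EuclideanSpace ℝ (Fin n))
    (K S : Set (EuclideanSpace ℝ (Fin n))) (x : ℝ → EuclideanSpace ℝ (Fin n)) (t T : ℕ → ℝ)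
    (u : ℕ → ℝ → EuclideanSpace ℝ (Fin n)) : Prop where
  zero : t 0 = 0
  succ : ∀ k, t (k + 1) = t k + T k
  isArc : ∀ k, IsArc f K S (T k) (u k)
  eq : ∀ k, ∀ s ∈ Ico 0 (T k), u k s = x (t k + s)
  jump : ∀ k, u (k + 1) 0 = g (u k (T k))

theorem IsHybridSolution.exists_isArcDecomposition (hS : IsClosed S) (hK : IsClosed K)
    (hinv : StrictlyForwardInvariant f g S K)
    (hreach : ∀ x₀ ∈ K \ S, ∀ x, IsHybridSolution f g S x₀ x → ReachesSurface S x)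
    (hx₀ : x₀ ∈ K) (hx : IsHybridSolution f g S x₀ x) :
    ∃ t T u, IsArcDecomposition f g K S x t T u := by
  have key : ∀ t : ℝ, 0 ≤ t → ∃ T u, IsArc f K S T u ∧ (∀ s ∈ Ico 0 T, u s = x (t + s)) ∧
      x (t + T) = g (u T) := fun t ht => by
    have hxK : x t ∈ K := hinv.mem hK hx₀ hx ht
    have hsh := hx.shift ht
    exact hsh.exists_isArc hS hK (fun s hs => hinv.mem hK hxK hsh hs)
      (hreach _ ⟨hxK, (hx.flow t ht).1⟩ _ hsh)
  choose! D w hw heq hjump using key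
  let t : ℕ → ℝ := fun k => Nat.rec 0 (fun _ s => s + D s) k
  have hsucc : ∀ k, t (k + 1) = t k + D (t k) := fun k => rfl
  have ht : ∀ k, 0 ≤ t k := fun k => by
    induction k with
    | zero => exact le_rfl
    | succ k ih => rw [hsucc]; exact add_nonneg ih (hw _ ih).pos.le
  refine ⟨t, fun k => D (t k), fun k => w (t k), rfl, hsucc, fun k => hw _ (ht k),
    fun k => heq _ (ht k), fun k => ?_⟩
  rw [heq _ (ht (k + 1)) 0 ⟨le_rfl, (hw _ (ht (k + 1))).pos⟩, add_zero, ← hjump _ (ht k), hsucc]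

end HybridSolutions

section Durations

variable {E : Type*} [NormedAddCommGroup E] [InnerProductSpace ℝ E]
  {f g : E → E} {M : E → E →L[ℝ] E →L[ℝ] ℝ} {K S G : Set E} {z : E} {b r L m : ℝ}

theorem UniformBounds.exists_le_duration (H : UniformBounds f g M K L) (hS : IsClosed S)
    (hG : IsCompact G) (hGS : G ⊆ K \ S) :
    ∃ Tmin > 0, ∀ T u, IsArc f K S T u → u 0 ∈ G → Tmin ≤ T := by
  have hL := zero_lt_one.trans_le H.one_le
  obtain ⟨δ, hδ, hsub⟩ := hG.exists_thickening_subset_open hS.isOpen_compl fun x hx => (hGS hx).2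
  refine ⟨δ / L, by positivity, fun T u hu h0 => ?_⟩
  rw [div_le_iff₀' hL]
  by_contra! hlt
  refine hsub (Metric.mem_thickening_iff.2 ⟨u 0, h0, ?_⟩) hu.hit
  rw [dist_eq_norm]
  exact (hu.norm_sub_le H le_rfl hu.pos.le le_rfl).trans_lt (by simpa using hlt)

theorem ContractingTube.exists_duration_le (h : ContractingTube f g M K S z b r L m)
    (hG : IsCompact G) (hex : ∀ a ∈ G, ∃ T u, IsArc f K S T u ∧ u 0 = a) :
    ∃ Tmax, ∀ T u, IsArc f K S T u → u 0 ∈ G → T ≤ Tmax := by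
  have H := h.bounds
  have hL := zero_lt_one.trans_le H.one_le
  have hm := h.speed_pos
  refine hG.induction_on (p := fun s => ∃ Tmax, ∀ T u, IsArc f K S T u → u 0 ∈ s → T ≤ Tmax)
    ⟨0, by simp⟩ (fun s t hst ⟨A, hA⟩ => ⟨A, fun T u hu h0 => hA T u hu (hst h0)⟩)
    (fun s t ⟨A, hA⟩ ⟨B, hB⟩ => ⟨max A B, fun T u hu h0 => h0.elim
      (fun h0 => (hA T u hu h0).trans (le_max_left _ _))
      (fun h0 => (hB T u hu h0).trans (le_max_right _ _))⟩) fun a ha => ?_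
  obtain ⟨T, u, hu, rfl⟩ := hex a ha
  -- nearby arcs are within `D` of `u` up to the impact of `u`, which forces their own impact
  obtain ⟨Q, hQ⟩ : ∃ Q, Q = ‖z‖ * (L * (1 + L * (2 * ‖z‖ / m))) := ⟨_, rfl⟩
  have hQ0 : 0 ≤ Q := by rw [hQ]; positivity
  set D := m / (2 * (Q + 1)) with hD
  have hD0 : 0 < D := by positivity
  have hsmall : Q * D ≤ m / 2 := by
    calc Q * D ≤ (Q + 1) * D := by gcongr; linarith
      _ = m / 2 := by rw [hD]; field_simp
  refine ⟨Metric.ball (u 0) (D / Real.exp (L * T)), mem_nhdsWithin_of_mem_nhds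
    (Metric.ball_mem_nhds _ (by positivity)), T + 2 * ‖z‖ / m * D, fun T' v hv h0 => ?_⟩
  rcases le_total T' T with hle | hle
  · have : 0 ≤ 2 * ‖z‖ / m * D := by positivity
    linarith
  · rw [mem_ball_iff_norm, lt_div_iff₀ (Real.exp_pos _)] at h0
    have h1 := (hu.norm_sub_le_exp H hv hle ⟨hu.pos.le, le_rfl⟩).trans h0.le
    rw [hQ] at hsmall
    linarith [hu.sub_le_of_norm_sub_le H h.mem_surface h.inner_lt hm h.le_speed hv h1 hsmall]

end Durations

/-! ### Changes of time -/

section Reparametrization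

/-- An increasing sequence of times tending to infinity is the image of `0, 1, 2, …` under a
piecewise affine order isomorphism of `[0, ∞)`. -/
theorem exists_orderIso_interpolating {t : ℕ → ℝ} (ht0 : t 0 = 0) (hmono : StrictMono t)
    (htop : Tendsto t atTop atTop) :
    ∃ h : NNReal ≃o NNReal, ∀ s : NNReal,
      (h s : ℝ) = t ⌊s⌋₊ + ((s : ℝ) - ⌊s⌋₊) * (t (⌊s⌋₊ + 1) - t ⌊s⌋₊) := by
  have hnn : ∀ k, 0 ≤ t k := fun k => ht0 ▸ hmono.monotone (Nat.zero_le k)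
  have hpos : ∀ k, 0 < t (k + 1) - t k := fun k => sub_pos.2 (hmono k.lt_succ_self)
  set φ : NNReal → ℝ := fun s => t ⌊s⌋₊ + ((s : ℝ) - ⌊s⌋₊) * (t (⌊s⌋₊ + 1) - t ⌊s⌋₊) with hφ
  have hfl : ∀ s : NNReal, (⌊s⌋₊ : ℝ) ≤ s := fun s => by exact_mod_cast Nat.floor_le zero_le
  have hlt : ∀ s : NNReal, (s : ℝ) < ⌊s⌋₊ + 1 := fun s => by exact_mod_cast Nat.lt_floor_add_one s
  have hge : ∀ s, t ⌊s⌋₊ ≤ φ s := fun s => by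
    have := mul_nonneg (sub_nonneg.2 (hfl s)) (hpos ⌊s⌋₊).le
    simp only [hφ]; linarith
  have hφlt : ∀ s, φ s < t (⌊s⌋₊ + 1) := fun s => by
    have h1 : (s : ℝ) - ⌊s⌋₊ < 1 := by linarith [hlt s]
    have := mul_lt_mul_of_pos_right h1 (hpos ⌊s⌋₊)
    simp only [hφ]; linarith
  have hφnn : ∀ s, 0 ≤ φ s := fun s => (hnn _).trans (hge s)
  have hφmono : StrictMono φ := fun a c hac => by
    rcases (Nat.floor_mono hac.le).eq_or_lt with h | h
    · have h1 : (a : ℝ) < c := hac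
      simp only [hφ, h]
      have := mul_lt_mul_of_pos_right (sub_lt_sub_right h1 (⌊c⌋₊ : ℝ)) (hpos ⌊c⌋₊)
      linarith
    · exact (hφlt a).trans_le ((hmono.monotone h).trans (hge c))
  refine ⟨StrictMono.orderIsoOfSurjective (fun s => (⟨φ s, hφnn s⟩ : NNReal))
    (fun a c hac => hφmono hac) (fun y => ?_), fun s => rfl⟩
  obtain ⟨k, hk1, hk2⟩ : ∃ k, t k ≤ y ∧ (y : ℝ) < t (k + 1) := by
    have hex : ∃ k, (y : ℝ) < t k := (htop.eventually_gt_atTop (y : ℝ)).exists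
    have hne : Nat.find hex ≠ 0 := fun h0 => by
      have := Nat.find_spec hex
      rw [h0, ht0] at this
      exact absurd y.2 (not_le.2 this)
    obtain ⟨k, hk⟩ := Nat.exists_eq_succ_of_ne_zero hne
    refine ⟨k, not_lt.1 (Nat.find_min hex (by omega)), ?_⟩
    have := Nat.find_spec hex
    rwa [hk] at this
  set c : ℝ := (y - t k) / (t (k + 1) - t k) with hc
  have hc0 : 0 ≤ c := div_nonneg (by linarith) (hpos k).le
  have hc1 : c < 1 := by rw [hc, div_lt_one (hpos k)]; linarith
  obtain ⟨w, hw⟩ : ∃ w : NNReal, (w : ℝ) = k + c := ⟨⟨k + c, by positivity⟩, rfl⟩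
  have hfloor : ⌊w⌋₊ = k := by
    rw [Nat.floor_eq_iff zero_le]
    constructor
    · rw [← NNReal.coe_le_coe, hw]; simpa using hc0
    · rw [← NNReal.coe_lt_coe, hw]; simpa using hc1
  refine ⟨w, NNReal.coe_injective ?_⟩
  change φ w = y
  simp only [hφ, hfloor, hw, add_sub_cancel_left, hc]
  rw [div_mul_cancel₀ _ (hpos k).ne']
  ring

/-- Two curves on `[0, ∞)` are asymptotic up to an increasing change of time. -/
def AsymptoticUpToTimeChange {X : Type*} [PseudoMetricSpace X] (x y : ℝ → X) : Prop :=
  ∃ τ : NNReal ≃o NNReal,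
    Tendsto (fun t : NNReal => dist (x (t : ℝ)) (y (τ t : ℝ))) atTop (𝓝 0)

namespace AsymptoticUpToTimeChange

variable {X : Type*} [PseudoMetricSpace X] {x y w : ℝ → X}

theorem of_common_time (h₁ h₂ : NNReal ≃o NNReal)
    (h : Tendsto (fun t : NNReal => dist (x (h₁ t : ℝ)) (y (h₂ t : ℝ))) atTop (𝓝 0)) :
    AsymptoticUpToTimeChange x y :=
  ⟨h₁.symm.trans h₂, by simpa [Function.comp_def] using h.comp h₁.symm.tendsto_atTop⟩

theorem symm (h : AsymptoticUpToTimeChange x y) : AsymptoticUpToTimeChange y x := by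
  obtain ⟨τ, hτ⟩ := h
  exact of_common_time τ (OrderIso.refl _) (by simpa [dist_comm] using hτ)

theorem trans (h : AsymptoticUpToTimeChange x y) (h' : AsymptoticUpToTimeChange y w) :
    AsymptoticUpToTimeChange x w := by
  obtain ⟨τ, hτ⟩ := h
  obtain ⟨σ, hσ⟩ := h'
  refine ⟨τ.trans σ, squeeze_zero (fun _ => dist_nonneg) (fun t => dist_triangle _ (y (τ t)) _) ?_⟩
  simpa using hτ.add (hσ.comp τ.tendsto_atTop)

end AsymptoticUpToTimeChange

variable {n : ℕ} {f g : EuclideanSpace ℝ (Fin n) → EuclideanSpace ℝ (Fin n)}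
  {S K : Set (EuclideanSpace ℝ (Fin n))} {x y : ℝ → EuclideanSpace ℝ (Fin n)}
  {t T s T' : ℕ → ℝ} {u v : ℕ → ℝ → EuclideanSpace ℝ (Fin n)} {C Tmin : ℝ}

theorem IsArcDecomposition.exists_orderIso (hx : IsArcDecomposition f g K S x t T u)
    (hTmin : 0 < Tmin) (hT : ∀ k, Tmin ≤ T k) :
    ∃ h : NNReal ≃o NNReal, ∀ r : NNReal,
      ((r : ℝ) - ⌊r⌋₊) ∈ Icc (0 : ℝ) 1 ∧
        x (h r) = u ⌊r⌋₊ (((r : ℝ) - ⌊r⌋₊) * T ⌊r⌋₊) := by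
  have hmono : StrictMono t := strictMono_nat_of_lt_succ fun k => by
    rw [hx.succ]; linarith [hT k]
  have hge : ∀ k : ℕ, (k : ℝ) * Tmin ≤ t k := fun k => by
    induction k with
    | zero => simp [hx.zero]
    | succ k ih => rw [hx.succ]; push_cast; linarith [hT k]
  have htop : Tendsto t atTop atTop :=
    tendsto_atTop_mono hge (tendsto_natCast_atTop_atTop.atTop_mul_const hTmin)
  obtain ⟨h, hh⟩ := exists_orderIso_interpolating hx.zero hmono htop
  refine ⟨h, fun r => ?_⟩
  have h0 : 0 ≤ (r : ℝ) - ⌊r⌋₊ := sub_nonneg.2 (by exact_mod_cast Nat.floor_le zero_le)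
  have h1 : (r : ℝ) - ⌊r⌋₊ < 1 := by
    have : (r : ℝ) < ⌊r⌋₊ + 1 := by exact_mod_cast Nat.lt_floor_add_one r
    linarith
  have hTp := (hx.isArc ⌊r⌋₊).pos
  refine ⟨⟨h0, h1.le⟩, ?_⟩
  rw [hx.eq _ _ ⟨mul_nonneg h0 hTp.le, mul_lt_of_lt_one_left hTp h1⟩, hh, hx.succ,
    add_sub_cancel_left]

/-- The time change that matches the `k`-th arcs affinely makes two curves asymptotic as soon as
the starting points of their `k`-th arcs approach each other. -/
theorem IsArcDecomposition.asymptotic (hx : IsArcDecomposition f g K S x t T u)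
    (hy : IsArcDecomposition f g K S y s T' v) (hTmin : 0 < Tmin) (hT : ∀ k, Tmin ≤ T k)
    (hT' : ∀ k, Tmin ≤ T' k)
    (hle : ∀ k, ∀ c ∈ Icc (0 : ℝ) 1, ‖v k (c * T' k) - u k (c * T k)‖ ≤ C * ‖v k 0 - u k 0‖)
    (hlim : Tendsto (fun k => ‖v k 0 - u k 0‖) atTop (𝓝 0)) :
    AsymptoticUpToTimeChange x y := by
  obtain ⟨h₁, hh₁⟩ := hx.exists_orderIso hTmin hT
  obtain ⟨h₂, hh₂⟩ := hy.exists_orderIso hTmin hT'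
  refine AsymptoticUpToTimeChange.of_common_time h₁ h₂ ?_
  have hlim' : Tendsto (fun r : NNReal => C * ‖v ⌊r⌋₊ 0 - u ⌊r⌋₊ 0‖) atTop (𝓝 0) := by
    simpa using (hlim.comp tendsto_nat_floor_atTop).const_mul C
  refine squeeze_zero (fun _ => dist_nonneg) (fun r => ?_) hlim'
  rw [(hh₁ r).2, (hh₂ r).2, dist_eq_norm, norm_sub_rev]
  exact hle _ _ (hh₁ r).1

end Reparametrization

/-! ### Asymptotic solutions -/

section Contraction

variable {n : ℕ} {f g : EuclideanSpace ℝ (Fin n) → EuclideanSpace ℝ (Fin n)}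
  {M : EuclideanSpace ℝ (Fin n) →
    EuclideanSpace ℝ (Fin n) →L[ℝ] EuclideanSpace ℝ (Fin n) →L[ℝ] ℝ}
  {S K G : Set (EuclideanSpace ℝ (Fin n))} {z : EuclideanSpace ℝ (Fin n)} {b r L m : ℝ}

/-- Curves whose arcs start in a compact set `G` off the surface are asymptotic as soon as their
initial states are close: the energy decays geometrically along the impacts. -/
theorem ContractingTube.exists_asymptotic (h : ContractingTube f g M K S z b r L m)
    (hS : IsClosed S) (hG : IsCompact G) (hGS : G ⊆ K \ S) (hgG : ∀ x ∈ K ∩ S, g x ∈ G)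
    (hex : ∀ a ∈ G, ∃ T u, IsArc f K S T u ∧ u 0 = a) :
    ∃ ρ > 0, ∀ x y t T u s T' v, IsArcDecomposition f g K S x t T u →
      IsArcDecomposition f g K S y s T' v → u 0 0 ∈ G → v 0 0 ∈ G → ‖v 0 0 - u 0 0‖ ≤ ρ →
      AsymptoticUpToTimeChange x y := by
  have H := h.bounds
  have hL := zero_lt_one.trans_le H.one_le
  obtain ⟨Tmin, hTmin, hmin⟩ := H.exists_le_duration hS hG hGS
  obtain ⟨Tmax, hmax⟩ := h.exists_duration_le hG hex
  obtain ⟨C, hC, κ, hκ, ε, hε, hstep⟩ := h.exists_contraction hTmin Tmax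
  refine ⟨ε / L, by positivity, fun x y t T u s T' v hx hy hu0 hv0 hd => ?_⟩
  have hstart : ∀ {x t T u}, IsArcDecomposition f g K S x t T u → u 0 0 ∈ G → ∀ k, u k 0 ∈ G := by
    intro x t T u hx h0 k
    cases k with
    | zero => exact h0
    | succ k => rw [hx.jump]; exact hgG _ ⟨(hx.isArc k).mem_end, (hx.isArc k).hit⟩
  have hu := hstart hx hu0
  have hv := hstart hy hv0
  have hT : ∀ k, T k ∈ Icc Tmin Tmax := fun k =>
    ⟨hmin _ _ (hx.isArc k) (hu k), hmax _ _ (hx.isArc k) (hu k)⟩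
  have hT' : ∀ k, T' k ∈ Icc Tmin Tmax := fun k =>
    ⟨hmin _ _ (hy.isArc k) (hv k), hmax _ _ (hy.isArc k) (hv k)⟩
  have hE0 : localEnergy M (u 0 0) (v 0 0) ≤ L * (ε / L) ^ 2 :=
    (H.localEnergy_le (hGS hu0).1).trans (by gcongr)
  have hdist : ∀ k, localEnergy M (u k 0) (v k 0) ≤ κ ^ k * (L * (ε / L) ^ 2) →
      ‖v k 0 - u k 0‖ ^ 2 ≤ κ ^ k * ε ^ 2 := fun k hk => by
    calc ‖v k 0 - u k 0‖ ^ 2 ≤ L * localEnergy M (u k 0) (v k 0) :=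
          H.sq_norm_le _ (hGS (hu k)).1 _
      _ ≤ L * (κ ^ k * (L * (ε / L) ^ 2)) := by gcongr
      _ = κ ^ k * ε ^ 2 := by field_simp
  have hsmall : ∀ k, localEnergy M (u k 0) (v k 0) ≤ κ ^ k * (L * (ε / L) ^ 2) →
      ‖v k 0 - u k 0‖ ≤ ε := fun k hk => by
    refine (abs_le_of_sq_le_sq' ((hdist k hk).trans ?_) hε.le).2
    exact mul_le_of_le_one_left (sq_nonneg ε) (pow_le_one₀ hκ.1 hκ.2.le)
  have hE : ∀ k, localEnergy M (u k 0) (v k 0) ≤ κ ^ k * (L * (ε / L) ^ 2) := fun k => by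
    induction k with
    | zero => simpa using hE0
    | succ k ih =>
      rw [hx.jump, hy.jump, pow_succ', mul_assoc]
      refine (hstep _ _ _ _ (hx.isArc k) (hy.isArc k) (hT k) (hT' k) (hsmall k ih)).2.trans ?_
      exact mul_le_mul_of_nonneg_left ih hκ.1
  refine hx.asymptotic hy hTmin (fun k => (hT k).1) (fun k => (hT' k).1)
    (fun k => (hstep _ _ _ _ (hx.isArc k) (hy.isArc k) (hT k) (hT' k) (hsmall k (hE k))).1) ?_
  have h2 : Tendsto (fun k => ‖v k 0 - u k 0‖ ^ 2) atTop (𝓝 0) := by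
    refine squeeze_zero (fun _ => sq_nonneg _) (fun k => hdist k (hE k)) ?_
    simpa using (tendsto_pow_atTop_nhds_zero_of_lt_one hκ.1 hκ.2).mul_const (ε ^ 2)
  simpa using h2.sqrt

/-- The transverse contraction condition with the derivatives of the square root carried out. -/
theorem TransverseContractingOn.energy_le (hcontr : TransverseContractingOn f M K r)
    (hM : ∀ x ∈ K, HasFDerivAt M (fderiv ℝ M x) x) (hsymm : ∀ x ∈ K, ∀ v w, M x v w = M x w v)
    (hpos : ∀ x ∈ K, ∀ v, v ≠ 0 → 0 < M x v v) :
    ∀ x ∈ K, ∀ w, M x (f x) w = 0 →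
      fderiv ℝ M x (f x) w w + 2 * M x w (fderiv ℝ f x w) ≤ -(2 * r) * M x w w := by
  intro x hx w hw
  rcases eq_or_ne w 0 with rfl | hw0
  · simp
  have hp := hpos x hx w hw0
  have hV : 0 < metricNorm M x w := Real.sqrt_pos.2 hp
  have hsq : metricNorm M x w ^ 2 = M x w w := Real.sq_sqrt hp.le
  have d1 : ∀ v, fderiv ℝ (fun η => metricNorm M x η) w v = M x w v / metricNorm M x w := by
    intro v
    have h1 : HasFDerivAt (fun η => M x η η) _ w :=
      (M x).hasFDerivAt.clm_apply (hasFDerivAt_id w)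
    have h2 := (h1.sqrt hp.ne').fderiv
    unfold metricNorm
    rw [h2]
    simp [hsymm x hx v w]
    field_simp
    ring
  have d2 : fderiv ℝ (fun y => metricNorm M y w) x (f x) =
      fderiv ℝ M x (f x) w w / (2 * metricNorm M x w) := by
    have h1 : HasFDerivAt (fun y => M y w w) _ x :=
      ((hM x hx).clm_apply (hasFDerivAt_const w x)).clm_apply (hasFDerivAt_const w x)
    have h2 := (h1.sqrt hp.ne').fderiv
    unfold metricNorm
    rw [h2]
    simp
    field_simp
  have key := hcontr x hx w hw0 (by rw [d1, hsymm x hx, hw, zero_div])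
  rw [d1, d2] at key
  have h3 := mul_le_mul_of_nonneg_left key (by positivity : 0 ≤ 2 * metricNorm M x w)
  have h4 : 2 * metricNorm M x w * (fderiv ℝ M x (f x) w w / (2 * metricNorm M x w) +
      M x w (fderiv ℝ f x w) / metricNorm M x w) =
      fderiv ℝ M x (f x) w w + 2 * M x w (fderiv ℝ f x w) := by field_simp
  rw [h4] at h3
  calc _ ≤ _ := h3
    _ = -(2 * r) * metricNorm M x w ^ 2 := by ring
    _ = _ := by rw [hsq]

/-- A preconnected set off the hyperplane lies on one side of it; the normal vector can be chosen
to point to the other side. -/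
theorem exists_normal_of_isPreconnected (htube : IsPreconnected (K \ switchingSurface z b)) :
    ∃ σ : ℝ, σ ≠ 0 ∧ (∀ x ∈ K \ switchingSurface z b, inner ℝ (σ • z) x < σ * b) := by
  by_cases hneg : ∀ x ∈ K \ switchingSurface z b, inner ℝ z x < b
  · exact ⟨1, one_ne_zero, by simpa using hneg⟩
  · push Not at hneg
    obtain ⟨x₁, hx₁, h₁⟩ := hneg
    refine ⟨-1, by simp, fun x hx => ?_⟩
    by_contra! hle
    have hle' : inner ℝ z x ≤ b := by simpa [inner_neg_left] using hle
    have hc : ContinuousOn (fun x => inner ℝ z x) (K \ switchingSurface z b) := by fun_prop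
    obtain ⟨y, hy, hyb⟩ := htube.intermediate_value hx hx₁ hc ⟨hle', h₁⟩
    exact hy.2 (sub_eq_zero.2 hyb)

end Contraction

theorem theorem2 {n : ℕ}
    (f g : EuclideanSpace ℝ (Fin n) → EuclideanSpace ℝ (Fin n))
    (M : EuclideanSpace ℝ (Fin n) →
      EuclideanSpace ℝ (Fin n) →L[ℝ] EuclideanSpace ℝ (Fin n) →L[ℝ] ℝ)
    (K U : Set (EuclideanSpace ℝ (Fin n)))
    (z : EuclideanSpace ℝ (Fin n)) (b r : ℝ)
    -- the data: smooth dynamics and a smooth metric near the compact set `K`, a hyperplane `S`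
    (hU : IsOpen U) (hKU : K ⊆ U) (hK : IsCompact K)
    (hf : ContDiffOn ℝ ∞ f U) (hg : ContDiffOn ℝ ∞ g U)
    (hM : IsRiemannianMetricOn M U)
    (hz : z ≠ 0)
    -- standing assumptions: `K` is strictly forward invariant and consists of a single continuous
    -- tube, without equilibria, whose solutions run into `S` and which is not tangent to `S`
    (hinv : StrictlyForwardInvariant f g (switchingSurface z b) K)
    (htube : IsPreconnected (K \ switchingSurface z b))
    (heq : ∀ x ∈ K, f x ≠ 0)
    (hreach : ∀ x₀ ∈ K \ switchingSurface z b, ∀ x,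
      IsHybridSolution f g (switchingSurface z b) x₀ x → ReachesSurface (switchingSurface z b) x)
    (htrans : ∀ x ∈ K ∩ switchingSurface z b, inner ℝ (f x) z ≠ 0)
    -- first condition: transverse contraction of the continuous part
    (hr : 0 < r) (hcontr : TransverseContractingOn f M K r)
    -- second condition: solutions approach `S` orthogonally with respect to `M`
    (horth : ∀ x ∈ K ∩ switchingSurface z b, ∀ δ, inner ℝ z δ = 0 → M x (f x) δ = 0)
    -- third condition: the impulse does not expand transverse displacements
    (hjump : ∀ x ∈ K ∩ switchingSurface z b, ∀ δ, M x δ (f x) = 0 →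
      M (g x) (fderiv ℝ g x δ) (fderiv ℝ g x δ) ≤ M x δ δ)
    -- two solutions in `K`
    (p₁ p₂ : EuclideanSpace ℝ (Fin n)) (hp₁ : p₁ ∈ K) (hp₂ : p₂ ∈ K)
    (x₁ x₂ : ℝ → EuclideanSpace ℝ (Fin n))
    (hx₁ : IsHybridSolution f g (switchingSurface z b) p₁ x₁)
    (hx₂ : IsHybridSolution f g (switchingSurface z b) p₂ x₂) :
    -- `τ` is an order isomorphism, i.e. an increasing homeomorphism, of `[0, ∞)`
    ∃ τ : NNReal ≃o NNReal,
      Tendsto (fun t : NNReal => dist (x₁ (t : ℝ)) (x₂ (τ t : ℝ))) atTop (𝓝 0) := by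
  obtain ⟨σ, hσ, hside⟩ := exists_normal_of_isPreconnected htube
  have hmem : ∀ x, x ∈ switchingSurface z b ↔ inner ℝ (σ • z) x = σ * b := fun x => by
    rw [real_inner_smul_left, mul_right_inj' hσ]
    exact sub_eq_zero
  have hSc : IsClosed (switchingSurface z b) :=
    isClosed_eq (by fun_prop) continuous_const
  generalize switchingSurface z b = S at *
  obtain ⟨L, H⟩ := exists_uniformBounds hU hKU hK hf hg hM.smooth hM.posDef
  obtain ⟨m, hm, hfm⟩ := exists_le_inner_field (z := σ • z) (b := σ * b) hK
    (hf.continuousOn.mono hKU) hmem fun x hx => by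
      rw [real_inner_smul_right]; exact mul_ne_zero hσ (htrans x hx)
  -- the state after an impulse at a point of `K` is in `K` and off `S`
  have hgS : ∀ x ∈ K ∩ S, g x ∈ K \ S := fun p hp => by
    obtain ⟨x, hx⟩ := (hinv p hp.1).1
    rw [← hx.init_jump hp.2]
    exact ⟨hinv.mem hK.isClosed hp.1 hx le_rfl, (hx.flow 0 le_rfl).1⟩
  have hMd : ∀ x ∈ K, HasFDerivAt M (fderiv ℝ M x) x := fun x hx =>
    ((hM.smooth.contDiffAt (hU.mem_nhds (hKU hx))).differentiableAt (by simp)).hasFDerivAt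
  have hsymm : ∀ x ∈ K, ∀ v w, M x v w = M x w v := fun x hx => hM.symm x (hKU hx)
  have htub : ContractingTube f g M K S (σ • z) (σ * b) r L m :=
    { bounds := H
      field_hasFDerivAt := fun x hx =>
        ((hf.contDiffAt (hU.mem_nhds (hKU hx))).differentiableAt (by simp)).hasFDerivAt
      metric_hasFDerivAt := hMd
      symm := hsymm
      field_ne_zero := heq
      rate_pos := hr
      contracting := hcontr.energy_le hMd hsymm fun x hx => hM.posDef x (hKU hx)
      mem_surface := hmem
      inner_lt := hside
      speed_pos := hm
      le_speed := hfm
      orthogonal := fun x hx w hw => horth x hx w (by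
        rw [real_inner_smul_left] at hw
        exact (mul_eq_zero.1 hw).resolve_left hσ)
      jump_le := hjump
      jump_mem := fun x hx => (hgS x hx).1 }
  have hdec : ∀ a ∈ K \ S, ∀ x, IsHybridSolution f g S a x →
      ∃ t T u, IsArcDecomposition f g K S x t T u ∧ u 0 0 = a := fun a ha x hx => by
    obtain ⟨t, T, u, hd⟩ := hx.exists_isArcDecomposition hSc hK.isClosed hinv hreach ha.1
    refine ⟨t, T, u, hd, ?_⟩
    rw [hd.eq 0 0 ⟨le_rfl, (hd.isArc 0).pos⟩, hd.zero, add_zero, hx.init_flow ha.2]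
  -- being asymptotic is an equivalence relation with open classes on the connected set `K \ S`
  have key : ∀ a ∈ K \ S, ∀ c ∈ K \ S, ∀ x y, IsHybridSolution f g S a x →
      IsHybridSolution f g S c y → AsymptoticUpToTimeChange x y := by
    intro a ha c hc
    refine htube.induction₂ (fun a c => ∀ x y, IsHybridSolution f g S a x →
      IsHybridSolution f g S c y → AsymptoticUpToTimeChange x y) (fun a ha => ?_)
      (fun a c d _ hc _ hac hcd x y hx hy => ?_)
      (fun a c _ _ hac x y hx hy => (hac y x hy hx).symm) ha hc
    · obtain ⟨δ, hδ, hδS⟩ := Metric.nhds_basis_closedBall.mem_iff.1 (hSc.isOpen_compl.mem_nhds ha.2)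
      have hSK : IsCompact (K ∩ S) := hK.inter_right hSc
      have hG : IsCompact (g '' (K ∩ S) ∪ K ∩ Metric.closedBall a δ) :=
        (hSK.image_of_continuousOn
          (hg.continuousOn.mono (inter_subset_left.trans hKU))).union
          (hK.inter_right Metric.isClosed_closedBall)
      have hGS : g '' (K ∩ S) ∪ K ∩ Metric.closedBall a δ ⊆ K \ S := by
        rintro x (⟨p, hp, rfl⟩ | ⟨hx, hxB⟩)
        · exact hgS p hp
        · exact ⟨hx, hδS hxB⟩
      obtain ⟨ρ, hρ, hasym⟩ := htub.exists_asymptotic hSc hG hGS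
        (fun x hx => Or.inl (mem_image_of_mem g hx)) (fun c hc => by
          obtain ⟨x, hx⟩ := (hinv c (hGS hc).1).1
          obtain ⟨t, T, u, hd, h0⟩ := hdec c (hGS hc) x hx
          exact ⟨T 0, u 0, hd.isArc 0, h0⟩)
      filter_upwards [mem_nhdsWithin_of_mem_nhds (Metric.closedBall_mem_nhds a hδ),
        mem_nhdsWithin_of_mem_nhds (Metric.closedBall_mem_nhds a hρ), self_mem_nhdsWithin]
        with c hcδ hcρ hc x y hx hy
      obtain ⟨t, T, u, hdx, hu⟩ := hdec a ha x hx
      obtain ⟨s, T', v, hdy, hv⟩ := hdec c hc y hy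
      refine hasym x y t T u s T' v hdx hdy
        (by rw [hu]; exact Or.inr ⟨ha.1, Metric.mem_closedBall_self hδ.le⟩)
        (by rw [hv]; exact Or.inr ⟨hc.1, hcδ⟩) ?_
      rw [hu, hv]
      exact mem_closedBall_iff_norm.1 hcρ
    · obtain ⟨w, hw⟩ := (hinv c hc.1).1
      exact (hac x w hx hw).trans (hcd w y hw hy)
  -- also for initial states on `S`, the state at time `0` is off `S`
  have hstart : ∀ p ∈ K, ∀ x, IsHybridSolution f g S p x →
      x 0 ∈ K \ S ∧ IsHybridSolution f g S (x 0) x := fun p hp x hx =>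
    ⟨⟨hinv.mem hK.isClosed hp hx le_rfl, (hx.flow 0 le_rfl).1⟩, by
      simpa using hx.shift le_rfl⟩
  obtain ⟨h1, h1'⟩ := hstart p₁ hp₁ x₁ hx₁
  obtain ⟨h2, h2'⟩ := hstart p₂ hp₂ x₂ hx₂
  exact key _ h1 _ h2 x₁ x₂ h1' h2'
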